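/- Let $X=(x_1,\dots,x_n)$ be a tuple of points of $[0,1]^d$ and let $k\ge 1$. For a tuple $A=(a_1,\dots,a_\ell)$ of points and a tuple $\mathcal C=(\mathcal C^1,\dots,\mathcal C^k)$ of centers put $f_A(\mathcal C)=\frac1\ell\sum_{i=1}^{\ell}\min_{j}\|a_i-\mathcal C^j\|^2$, and let $\mathrm{OPT}=\inf_{\mathcal C}f_X(\mathcal C)$ over all $k$-tuples of points of $\mathbb R^d$. Mini-batch $k$-means with batch size $b\ge 1$ and threshold $\epsilon>0$ runs as follows. The initial centers $\mathcal C_1$ are chosen by $k$-means++: the first center is uniform among $x_1,\dots,x_n$, and every later one is a data point drawn with probability proportional to its squared distance to the closest center chosen so far (uniformly, if all these distances vanish). In iteration $i=1,2,\dots$, independently of the past, a batch $B_i$ of $b$ points is sampled uniformly with repetitions from $X$. Every data point is assigned to a closest center of $\mathcal C_i$, ties being broken by an arbitrary fixed rule. With $B_i^j$ the part of the batch assigned to $\mathcal C_i^j$, $\alpha_i^j=\sqrt{|B_i^j|/b}$, and $\mathrm{cm}$ the center of mass, one sets $\mathcal C_{i+1}^j=(1-\alpha_i^j)\mathcal C_i^j+\alpha_i^j\,\mathrm{cm}(B_i^j)$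 (so $\mathcal C_{i+1}^j=\mathcal C_i^j$ if $B_i^j$ is empty). If $f_{B_i}(\mathcal C_i)-f_{B_i}(\mathcal C_{i+1})<\epsilon$, the algorithm stops and returns $\mathcal C_{i+1}$. There is an absolute constant $K$ such that for every $p\ge1$ there is a constant $A$, depending only on $p$, such that the following holds for all $n,k,b\ge1$, all $d$, all $\epsilon>0$ and all $X$ as above with $$b\ \ge\ A\,(d/\epsilon)^2\log(nkd/\epsilon).$$ 1. The algorithm terminates almost surely, and the centers $\mathcal C_{\mathrm{out}}$ that it returns satisfy $\mathbb E[f_X(\mathcal C_{\mathrm{out}})]\le K(1+\log k)\,\mathrm{OPT}$; so, for $k\ge2$, the expected approximation ratio is $O(\log k)$. 2. With probability at least $1-n^{-p}$, the algorithm terminates within $5d/\epsilon+1$ iterations, and $f_X(\mathcal C_{i+1})\le f_X(\mathcal C_i)-\epsilon/5$ for every iteration $i$ before the terminating one. -/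

import Mathlib

open MeasureTheory ProbabilityTheory

noncomputable section

namespace MiniBatchKMeans

/-- Points of `d`-dimensional Euclidean space. -/
abbrev Pt (d : ℕ) : Type := EuclideanSpace ℝ (Fin d)

/-- The cost of one point: squared distance to the closest of the `k` centers
(the infimum is over a finite index set, so it is a minimum when `k ≥ 1`). -/
def cost {d k : ℕ} (C : Fin k → Pt d) (x : Pt d) : ℝ :=
  ⨅ j : Fin k, ‖x - C j‖ ^ 2

/-- The goal function of a tuple of points `A` (the dataset or a batch):
the average cost of its entries. -/
def objective {d k l : ℕ} (A : Fin l → Pt d) (C : Fin k → Pt d) : ℝ :=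
  (1 / (l : ℝ)) * ∑ i : Fin l, cost C (A i)

/-- The optimal value of the `k`-means problem on the dataset `X`. -/
def opt {d n : ℕ} (k : ℕ) (X : Fin n → Pt d) : ℝ :=
  ⨅ C : Fin k → Pt d, objective X C

/-! ### Seeding by k-means++

A seeding is recorded as the tuple `s` of the indices of the chosen data points. -/

/-- Squared distance of the data point `X a` to the closest seed chosen before the `j`-th one
(only used when there is an earlier seed). -/
def seedDist {d n k : ℕ} (X : Fin n → Pt d) (s : Fin k → Fin n) (j : Fin k) (a : Fin n) : ℝ :=
  ⨅ i : {i : Fin k // i < j}, ‖X a - X (s i)‖ ^ 2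

open Classical in
/-- Conditional probability that k-means++ chooses the data point `a` as its `j`-th seed, given
the earlier seeds `s i`, `i < j`: the first seed is uniform, every later one is drawn with
probability proportional to the squared distance to the closest earlier seed
(and uniformly if all these distances vanish). -/
def seedStep {d n k : ℕ} (X : Fin n → Pt d) (s : Fin k → Fin n) (j : Fin k) (a : Fin n) : ℝ :=
  if (j : ℕ) = 0 ∨ ∑ a' : Fin n, seedDist X s j a' = 0 then 1 / (n : ℝ)
  else seedDist X s j a / ∑ a' : Fin n, seedDist X s j a'

/-- The probability that k-means++ produces the seeding `s`. -/
def kmeansppProb {d n k : ℕ} (X : Fin n → Pt d) (s : Fin k → Fin n) : ℝ :=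
  ∏ j : Fin k, seedStep X s j (s j)

/-! ### The mini-batch algorithm

A batch of size `b` is recorded as the tuple of the indices of the sampled data points. -/

/-- `τ` assigns, for every tuple of centers, every data point to a closest center;
ties are broken arbitrarily. -/
def IsNearest {d n k : ℕ} (X : Fin n → Pt d) (τ : (Fin k → Pt d) → Fin n → Fin k) : Prop :=
  ∀ (C : Fin k → Pt d) (a : Fin n) (j : Fin k), ‖X a - C (τ C a)‖ ≤ ‖X a - C j‖

/-- The positions of the batch whose points are assigned to the `j`-th center. -/
def part {d n k b : ℕ} (τ : (Fin k → Pt d) → Fin n → Fin k) (C : Fin k → Pt d)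
    (B : Fin b → Fin n) (j : Fin k) : Finset (Fin b) :=
  Finset.univ.filter fun l => τ C (B l) = j

/-- The center of mass of the batch points at the positions `S` (`0` if `S` is empty). -/
def centerOfMass {d n b : ℕ} (X : Fin n → Pt d) (B : Fin b → Fin n) (S : Finset (Fin b)) : Pt d :=
  (1 / (S.card : ℝ)) • ∑ l ∈ S, X (B l)

/-- The learning rate of the `j`-th center: the square root of the fraction of the batch
that is assigned to it. -/
def rate {d n k b : ℕ} (τ : (Fin k → Pt d) → Fin n → Fin k) (C : Fin k → Pt d)
    (B : Fin b → Fin n) (j : Fin k) : ℝ :=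
  Real.sqrt (((part τ C B j).card : ℝ) / (b : ℝ))

/-- One update of the centers. A center to which no batch point is assigned has rate `0`
and stays in place. -/
def update {d n k b : ℕ} (X : Fin n → Pt d) (τ : (Fin k → Pt d) → Fin n → Fin k)
    (C : Fin k → Pt d) (B : Fin b → Fin n) : Fin k → Pt d := fun j =>
  (1 - rate τ C B j) • C j + rate τ C B j • centerOfMass X B (part τ C B j)

/-- The centers before iteration `i` (iterations are numbered from `0`; iteration `i` uses the
batch `B i`), for the seeding `s`. -/
def centers {d n k b : ℕ} (X : Fin n → Pt d) (τ : (Fin k → Pt d) → Fin n → Fin k)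
    (s : Fin k → Fin n) (B : ℕ → Fin b → Fin n) : ℕ → Fin k → Pt d
  | 0 => fun j => X (s j)
  | i + 1 => update X τ (centers X τ s B i) (B i)

/-- The stopping condition of iteration `i`: on the batch of this iteration, the update improves
the goal function by less than `ε`. -/
def StopsAt {d n k b : ℕ} (X : Fin n → Pt d) (τ : (Fin k → Pt d) → Fin n → Fin k) (ε : ℝ)
    (s : Fin k → Fin n) (B : ℕ → Fin b → Fin n) (i : ℕ) : Prop :=
  objective (fun l => X (B i l)) (centers X τ s B i)
    - objective (fun l => X (B i l)) (centers X τ s B (i + 1)) < ε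

/-- The algorithm terminates. -/
def Terminates {d n k b : ℕ} (X : Fin n → Pt d) (τ : (Fin k → Pt d) → Fin n → Fin k) (ε : ℝ)
    (s : Fin k → Fin n) (B : ℕ → Fin b → Fin n) : Prop :=
  ∃ i : ℕ, StopsAt X τ ε s B i

/-- The iteration at which the algorithm terminates, i.e. the first one whose stopping condition
holds (only meaningful if the algorithm terminates). -/
def lastIter {d n k b : ℕ} (X : Fin n → Pt d) (τ : (Fin k → Pt d) → Fin n → Fin k) (ε : ℝ)
    (s : Fin k → Fin n) (B : ℕ → Fin b → Fin n) : ℕ :=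
  sInf {i : ℕ | StopsAt X τ ε s B i}

/-- The centers that the algorithm returns: those after the update of the last iteration. -/
def output {d n k b : ℕ} (X : Fin n → Pt d) (τ : (Fin k → Pt d) → Fin n → Fin k) (ε : ℝ)
    (s : Fin k → Fin n) (B : ℕ → Fin b → Fin n) : Fin k → Pt d :=
  centers X τ s B (lastIter X τ ε s B + 1)

end MiniBatchKMeans

end

/-! ### Cost of centers and the k-means++ seeding. -/

namespace MiniBatchKMeans

/-! ### Elementary facts on the cost -/

/-! Two estimates are multiplied: the k-means++ seeding has expected cost at most 16(1 + log k) OPT,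
and the iterations raise the expected cost by a factor of at most 10.

Seeding. Fix reference centers and the clusters they induce. A seed drawn inside one cluster with
probability proportional to the current cost leaves that cluster, on average, with at most 8 times
its reference cost (`sum_seedCost_mul_le`). Draws wasted on clusters that already contain a seed are
paid for by a harmonic sum, in an induction on the number of remaining seeds
(`expCost_le_seedBound`).

One batch. The difficulty is that the updated centers depend on the batch on which they are
evaluated. They are compared with the ideal update, which takes the whole dataset as its batch and
so is determined by the current centers. A center moves by a batch average divided by the square
root of its batch fraction. The variance of that average is controlled by the cluster's share w of
the data, so after division by √w the error no longer depends on w (`abs_div_sqrt_sub_div_sqrt_le`);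
the square-root learning rate serves exactly this. Closeness is needed only in the directions `X a -
C j`, because the displacements are themselves combinations of these vectors (`cost_update_le`). A
Bernstein bound and a union bound over O(nk) test functions then show that a batch is good with high
probability (`batchMean_not_isGood_le`). A good step that does not stop lowers the global cost by
ε/5; as the cost lies in [0, d], this bounds the number of iterations.

Expectation. The terminating update may raise the cost, and no additive loss is affordable, since
OPT can be far below ε. Counting the cost with weight 10 during the run and with weight 1 afterwards
gives a supermartingale (`batchMean_step_le`). If the cost is at least ε/10, the drop in weight or
the gain ε/5 pays for all losses. If it is smaller, continuing requires a batch cost of at least ε,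
which Chebyshev's inequality makes unlikely with a bound proportional to the cost itself. -/

theorem cost_le {d k : ℕ} (C : Fin k → Pt d) (x : Pt d) (j : Fin k) : cost C x ≤ ‖x - C j‖ ^ 2 :=
  ciInf_le (Set.finite_range _).bddBelow j

theorem cost_nonneg {d k : ℕ} (C : Fin k → Pt d) (x : Pt d) : 0 ≤ cost C x :=
  Real.iInf_nonneg fun _ => sq_nonneg _

theorem exists_cost_eq {d k : ℕ} (hk : 0 < k) (C : Fin k → Pt d) (x : Pt d) :
    ∃ j, cost C x = ‖x - C j‖ ^ 2 := by
  have : Nonempty (Fin k) := ⟨⟨0, hk⟩⟩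
  obtain ⟨j, hj⟩ := exists_eq_ciInf_of_finite (f := fun j : Fin k => ‖x - C j‖ ^ 2)
  exact ⟨j, hj.symm⟩

theorem objective_nonneg {d k l : ℕ} (A : Fin l → Pt d) (C : Fin k → Pt d) :
    0 ≤ objective A C :=
  mul_nonneg (by positivity) (Finset.sum_nonneg fun _ _ => cost_nonneg _ _)

theorem norm_sub_sq_le_two_mul {d : ℕ} (x y z : Pt d) :
    ‖x - z‖ ^ 2 ≤ 2 * ‖x - y‖ ^ 2 + 2 * ‖y - z‖ ^ 2 := by
  have h1 : ‖x - z‖ ≤ ‖x - y‖ + ‖y - z‖ := norm_sub_le_norm_sub_add_norm_sub x y z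
  nlinarith [sq_nonneg (‖x - y‖ - ‖y - z‖), norm_nonneg (x - z), norm_nonneg (x - y),
    norm_nonneg (y - z)]

theorem cost_le_two_mul {d k : ℕ} (hk : 0 < k) (C : Fin k → Pt d) (x y : Pt d) :
    cost C x ≤ 2 * cost C y + 2 * ‖y - x‖ ^ 2 := by
  obtain ⟨j, hj⟩ := exists_cost_eq hk C y
  have h1 := cost_le C x j
  have h2 := norm_sub_sq_le_two_mul x y (C j)
  rw [norm_sub_rev x y] at h2
  linarith

/-! ### k-means++ as a recursion on the number of seeds -/

/-- Squared distance of the data point `X a` to the closest of the seeds `s`. -/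
noncomputable def seedCost {d n m : ℕ} (X : Fin n → Pt d) (s : Fin m → Fin n) (a : Fin n) : ℝ :=
  cost (fun j => X (s j)) (X a)

theorem seedCost_nonneg {d n m : ℕ} (X : Fin n → Pt d) (s : Fin m → Fin n) (a : Fin n) :
    0 ≤ seedCost X s a := cost_nonneg _ _

/-- The tuple of seeds `s` extended by `a`. -/
def addSeed {n m : ℕ} (s : Fin m → Fin n) (a : Fin n) : Fin (m + 1) → Fin n :=
  Fin.snoc (α := fun _ => Fin n) s a

@[simp] theorem addSeed_last {n m : ℕ} (s : Fin m → Fin n) (a : Fin n) :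
    addSeed s a (Fin.last m) = a := Fin.snoc_last ..

@[simp] theorem addSeed_castSucc {n m : ℕ} (s : Fin m → Fin n) (a : Fin n) (j : Fin m) :
    addSeed s a j.castSucc = s j := Fin.snoc_castSucc ..

theorem seedCost_addSeed_le {d n m : ℕ} (hm : 0 < m) (X : Fin n → Pt d) (s : Fin m → Fin n)
    (a x : Fin n) : seedCost X (addSeed s a) x ≤ seedCost X s x := by
  obtain ⟨j, hj⟩ := exists_cost_eq hm (fun j => X (s j)) (X x)
  unfold seedCost
  rw [hj]
  simpa using cost_le (fun j => X (addSeed s a j)) (X x) j.castSucc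

theorem seedCost_addSeed_le_norm {d n m : ℕ} (X : Fin n → Pt d) (s : Fin m → Fin n)
    (a x : Fin n) : seedCost X (addSeed s a) x ≤ ‖X x - X a‖ ^ 2 := by
  simpa [seedCost] using cost_le (fun j => X (addSeed s a j)) (X x) (Fin.last m)

open Classical in
/-- The law of the seed following the seeds `s`. -/
noncomputable def nextProb {d n m : ℕ} (X : Fin n → Pt d) (s : Fin m → Fin n) (a : Fin n) : ℝ :=
  if ∑ a' : Fin n, seedCost X s a' = 0 then 1 / (n : ℝ)
  else seedCost X s a / ∑ a' : Fin n, seedCost X s a'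

theorem seedDist_castSucc {d n m : ℕ} (X : Fin n → Pt d) (s : Fin m → Fin n) (a : Fin n)
    (j : Fin m) (x : Fin n) : seedDist X (addSeed s a) j.castSucc x = seedDist X s j x := by
  unfold seedDist
  symm
  refine Function.Surjective.iInf_congr
    (fun i : {i : Fin m // i < j} => (⟨i.1.castSucc, by simpa using i.2⟩ :
      {i : Fin (m + 1) // i < j.castSucc})) ?_ ?_
  · rintro ⟨i, hi⟩
    have hi' : (i : ℕ) < (j : ℕ) := hi
    exact ⟨⟨⟨i, hi'.trans j.2⟩, hi'⟩, by ext; rfl⟩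
  · rintro ⟨i, hi⟩
    simp

theorem seedDist_last {d n m : ℕ} (X : Fin n → Pt d) (s : Fin m → Fin n) (a : Fin n)
    (x : Fin n) : seedDist X (addSeed s a) (Fin.last m) x = seedCost X s x := by
  unfold seedDist seedCost cost
  symm
  refine Function.Surjective.iInf_congr
    (fun i : Fin m => (⟨i.castSucc, Fin.castSucc_lt_last i⟩ :
      {i : Fin (m + 1) // i < Fin.last m})) ?_ ?_
  · rintro ⟨i, hi⟩
    exact ⟨⟨i, hi⟩, by ext; rfl⟩
  · intro i
    simp

theorem kmeansppProb_addSeed {d n m : ℕ} (hm : 0 < m) (X : Fin n → Pt d) (s : Fin m → Fin n)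
    (a : Fin n) : kmeansppProb X (addSeed s a) = kmeansppProb X s * nextProb X s a := by
  unfold kmeansppProb
  rw [Fin.prod_univ_castSucc]
  congr 1
  · refine Finset.prod_congr rfl fun j _ => ?_
    simp [seedStep, seedDist_castSucc]
  · simp [seedStep, seedDist_last, nextProb, hm.ne']

theorem sum_addSeed {n m : ℕ} (F : (Fin (m + 1) → Fin n) → ℝ) :
    ∑ s, F s = ∑ s : Fin m → Fin n, ∑ a, F (addSeed s a) := by
  rw [← (Fin.snocEquiv (fun _ => Fin n)).sum_comp, Fintype.sum_prod_type, Finset.sum_comm]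
  rfl

/-- The expected total cost after `t` further seeds have been added to `s`. -/
noncomputable def expCost {d n : ℕ} (X : Fin n → Pt d) : ℕ → ∀ {m : ℕ}, (Fin m → Fin n) → ℝ
  | 0, _, s => ∑ a, seedCost X s a
  | t + 1, _, s => ∑ a, nextProb X s a * expCost X t (addSeed s a)

theorem sum_kmeansppProb_expCost {d n k : ℕ} (X : Fin n → Pt d) (t : ℕ) :
    ∀ m : ℕ, 0 < m → m + t = k →
      ∑ s : Fin k → Fin n, kmeansppProb X s * expCost X 0 s
        = ∑ s : Fin m → Fin n, kmeansppProb X s * expCost X t s := by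
  induction t with
  | zero => rintro m - rfl; rfl
  | succ t ih =>
    intro m hm h
    rw [ih (m + 1) (by omega) (by omega), sum_addSeed]
    refine Finset.sum_congr rfl fun s _ => ?_
    simp only [expCost, kmeansppProb_addSeed hm, Finset.mul_sum, mul_assoc]

theorem sum_kmeansppProb_eq {d n k : ℕ} (hk : 0 < k) (X : Fin n → Pt d) :
    ∑ s : Fin k → Fin n, kmeansppProb X s * expCost X 0 s
      = 1 / (n : ℝ) * ∑ a, expCost X (k - 1) (fun _ : Fin 1 => a) := by
  rw [sum_kmeansppProb_expCost X (k - 1) 1 one_pos (by omega),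
    ← (Equiv.funUnique (Fin 1) (Fin n)).symm.sum_comp, Finset.mul_sum]
  refine Finset.sum_congr rfl fun a _ => ?_
  simp only [kmeansppProb, Finset.univ_unique, Finset.prod_singleton, seedStep]
  simp
  left; rfl

/-! ### Sampling a seed from one cluster -/

/-- Expanding around c turns this into an identity with the extra term -2‖∑ (X a - c)‖² on the
right. Hence a uniformly drawn point of a cluster costs, on average, at most twice what any center c
costs. -/
theorem sum_sum_norm_sub_sq_le {d n : ℕ} (X : Fin n → Pt d) (A : Finset (Fin n)) (c : Pt d) :
    ∑ a ∈ A, ∑ x ∈ A, ‖X x - X a‖ ^ 2 ≤ 2 * A.card * ∑ a ∈ A, ‖X a - c‖ ^ 2 := by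
  have key : ∑ a ∈ A, ∑ x ∈ A, ‖X x - X a‖ ^ 2
      = 2 * A.card * ∑ a ∈ A, ‖X a - c‖ ^ 2 - 2 * ‖∑ a ∈ A, (X a - c)‖ ^ 2 := by
    have h : ∀ a x, ‖X x - X a‖ ^ 2
        = ‖X x - c‖ ^ 2 - 2 * inner ℝ (X x - c) (X a - c) + ‖X a - c‖ ^ 2 := fun a x => by
      rw [← norm_sub_sq_real]; congr 2; abel
    simp only [h, Finset.sum_add_distrib, Finset.sum_sub_distrib, ← Finset.mul_sum,
      Finset.sum_const, nsmul_eq_mul, ← sum_inner, ← inner_sum, real_inner_self_eq_norm_sq]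
    ring
  rw [key]
  nlinarith [sq_nonneg ‖∑ a ∈ A, (X a - c)‖]

/-- D²-sampling inside one cluster. Averaging the relaxed triangle inequality over the cluster
bounds the weight of a by (2Φ + 2q)/|A|, where q is the cost of the cluster for the single center `X
a`. The new cost is at most both Φ and q, so the product is at most 4Φq/|A|, and the sum of q over a
is at most 2|A| times the reference cost. -/
theorem sum_seedCost_mul_le {d n m : ℕ} (hm : 0 < m) (X : Fin n → Pt d) (s : Fin m → Fin n)
    (A : Finset (Fin n)) (c : Pt d) :
    ∑ a ∈ A, seedCost X s a * ∑ x ∈ A, seedCost X (addSeed s a) x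
      ≤ 8 * (∑ a ∈ A, seedCost X s a) * ∑ a ∈ A, ‖X a - c‖ ^ 2 := by
  rcases A.eq_empty_or_nonempty with rfl | hA
  · simp
  have hcard : (0 : ℝ) < A.card := by exact_mod_cast hA.card_pos
  set Φ := ∑ a ∈ A, seedCost X s a with hΦ
  set T := ∑ a ∈ A, ∑ x ∈ A, ‖X x - X a‖ ^ 2 with hT
  have hT2 := sum_sum_norm_sub_sq_le X A c
  have hΦ0 : 0 ≤ Φ := Finset.sum_nonneg fun _ _ => seedCost_nonneg _ _ _
  have h1 : ∀ a, A.card * seedCost X s a ≤ 2 * Φ + 2 * ∑ x ∈ A, ‖X x - X a‖ ^ 2 := fun a => by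
    rw [hΦ, Finset.mul_sum, Finset.mul_sum, ← Finset.sum_add_distrib, ← nsmul_eq_mul]
    rw [← Finset.sum_const]
    exact Finset.sum_le_sum fun x _ => cost_le_two_mul hm _ _ _
  have h2 : ∀ a, (∑ x ∈ A, seedCost X (addSeed s a) x) ≤ Φ := fun a =>
    Finset.sum_le_sum fun x _ => seedCost_addSeed_le hm X s a x
  have h3 : ∀ a, (∑ x ∈ A, seedCost X (addSeed s a) x) ≤ ∑ x ∈ A, ‖X x - X a‖ ^ 2 := fun a =>
    Finset.sum_le_sum fun x _ => seedCost_addSeed_le_norm X s a x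
  have h4 : A.card * ∑ a ∈ A, seedCost X s a * ∑ x ∈ A, seedCost X (addSeed s a) x
      ≤ 4 * Φ * T := by
    have : 4 * Φ * T = ∑ a ∈ A, 4 * Φ * ∑ x ∈ A, ‖X x - X a‖ ^ 2 := by
      rw [hT, Finset.mul_sum]
    rw [this, Finset.mul_sum]
    refine Finset.sum_le_sum fun a _ => ?_
    have hg : 0 ≤ ∑ x ∈ A, seedCost X (addSeed s a) x :=
      Finset.sum_nonneg fun _ _ => seedCost_nonneg _ _ _
    have hq : 0 ≤ ∑ x ∈ A, ‖X x - X a‖ ^ 2 := Finset.sum_nonneg fun _ _ => sq_nonneg _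
    calc (A.card : ℝ) * (seedCost X s a * ∑ x ∈ A, seedCost X (addSeed s a) x)
        = (A.card * seedCost X s a) * ∑ x ∈ A, seedCost X (addSeed s a) x := by ring
      _ ≤ (2 * Φ + 2 * ∑ x ∈ A, ‖X x - X a‖ ^ 2) * ∑ x ∈ A, seedCost X (addSeed s a) x :=
          mul_le_mul_of_nonneg_right (h1 a) hg
      _ ≤ 4 * Φ * ∑ x ∈ A, ‖X x - X a‖ ^ 2 := by
          nlinarith [mul_le_mul_of_nonneg_left (h3 a) hΦ0, mul_le_mul_of_nonneg_left (h2 a) hq]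
  have h5 : 4 * Φ * T ≤ A.card * (8 * Φ * ∑ a ∈ A, ‖X a - c‖ ^ 2) := by
    nlinarith [mul_le_mul_of_nonneg_left hT2 hΦ0]
  exact le_of_mul_le_mul_left (h4.trans h5) hcard

/-- Disposes of the degenerate branch of `nextProb`, in which the seed is drawn uniformly. -/
theorem expCost_eq_zero {d n : ℕ} (X : Fin n → Pt d) (t : ℕ) :
    ∀ {m : ℕ} (_ : 0 < m) (s : Fin m → Fin n), ∑ a, seedCost X s a = 0 → expCost X t s = 0 := by
  induction t with
  | zero => exact fun _ s h => h
  | succ t ih =>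
    refine fun {m} hm s h => Finset.sum_eq_zero fun a _ => ?_
    rw [ih (by omega), mul_zero]
    refine le_antisymm ?_ (Finset.sum_nonneg fun _ _ => seedCost_nonneg _ _ _)
    rw [← h]
    exact Finset.sum_le_sum fun x _ => seedCost_addSeed_le hm X s a x

/-! ### The bound for a state with covered and uncovered clusters -/

/-- The cost of the `j`-th cluster of the assignment `σ` for the seeds `s`. -/
noncomputable def clusterCost {d n m k : ℕ} (X : Fin n → Pt d) (σ : Fin n → Fin k)
    (s : Fin m → Fin n) (j : Fin k) : ℝ :=
  ∑ a with σ a = j, seedCost X s a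

/-- The cost of the `j`-th cluster of the assignment `σ` for the reference center `c j`. -/
noncomputable def refCost {d n k : ℕ} (X : Fin n → Pt d) (σ : Fin n → Fin k)
    (c : Fin k → Pt d) (j : Fin k) : ℝ :=
  ∑ a with σ a = j, ‖X a - c j‖ ^ 2

/-- The clusters from which a seed has been chosen. -/
def covered {n m k : ℕ} (σ : Fin n → Fin k) (s : Fin m → Fin n) : Finset (Fin k) :=
  Finset.univ.image fun i => σ (s i)

theorem covered_addSeed {n m k : ℕ} (σ : Fin n → Fin k) (s : Fin m → Fin n) (a : Fin n) :
    covered σ (addSeed s a) = insert (σ a) (covered σ s) := by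
  ext j
  simp only [covered, Finset.mem_image, Finset.mem_univ, true_and, Finset.mem_insert]
  constructor
  · rintro ⟨i, rfl⟩
    induction i using Fin.lastCases with
    | last => simp
    | cast i => exact Or.inr ⟨i, by simp⟩
  · rintro (rfl | ⟨i, rfl⟩)
    · exact ⟨Fin.last m, by simp⟩
    · exact ⟨i.castSucc, by simp⟩

/-- The bound on the expected cost after `t` further seeds, in terms of the cost `c` of the covered
clusters, the cost `φ` and the reference cost `o` of the `u` uncovered ones. -/
noncomputable def seedBound (t : ℕ) (u c φ o : ℝ) : ℝ :=
  (c + 8 * o) * (1 + (harmonic t : ℝ)) + (u - t) / u * φ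

theorem harmonic_cast_nonneg (t : ℕ) : (0 : ℝ) ≤ (harmonic t : ℝ) := by
  have : (0 : ℚ) ≤ harmonic t := by
    unfold harmonic
    exact Finset.sum_nonneg fun _ _ => by positivity
  exact_mod_cast this

theorem seedBound_mono {t : ℕ} {u c c' φ φ' o : ℝ} (hu : (t : ℝ) ≤ u) (hc : c ≤ c')
    (hφ : φ ≤ φ') : seedBound t u c φ o ≤ seedBound t u c' φ' o := by
  have h0 := harmonic_cast_nonneg t
  have ht : (0 : ℝ) ≤ t := t.cast_nonneg
  unfold seedBound
  gcongr
  exact div_nonneg (by linarith) (by linarith)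

/-- Induction on t with the number u of uncovered clusters free. A draw from a covered cluster
wastes a seed and leaves an excess of φ/u over the intended bound; its probability makes this at
most c/(t+1), the new harmonic term. A draw from an uncovered cluster turns its cost, on average,
into at most 8 times its reference cost, which the summand 8o already contains. -/
theorem expCost_le_seedBound {d n k : ℕ} (X : Fin n → Pt d) (σ : Fin n → Fin k)
    (c : Fin k → Pt d) (t : ℕ) : ∀ {m : ℕ} (_ : 0 < m) (s : Fin m → Fin n),
    t ≤ (covered σ s)ᶜ.card →
    expCost X t s ≤ seedBound t (covered σ s)ᶜ.card (∑ j ∈ covered σ s, clusterCost X σ s j)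
      (∑ j ∈ (covered σ s)ᶜ, clusterCost X σ s j) (∑ j ∈ (covered σ s)ᶜ, refCost X σ c j) := by
  have hcl0 : ∀ {m : ℕ} (s : Fin m → Fin n) j, 0 ≤ clusterCost X σ s j := fun s j =>
    Finset.sum_nonneg fun _ _ => seedCost_nonneg _ _ _
  have hrf0 : ∀ j, 0 ≤ refCost X σ c j := fun j => Finset.sum_nonneg fun _ _ => sq_nonneg _
  have htot : ∀ {m : ℕ} (s : Fin m → Fin n), ∑ a, seedCost X s a
      = ∑ j ∈ covered σ s, clusterCost X σ s j + ∑ j ∈ (covered σ s)ᶜ, clusterCost X σ s j := by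
    intro m s
    rw [Finset.sum_add_sum_compl]
    exact (Finset.sum_fiberwise _ _ _).symm
  induction t with
  | zero =>
    intro m hm s _
    have ho : 0 ≤ ∑ j ∈ (covered σ s)ᶜ, refCost X σ c j := Finset.sum_nonneg fun j _ => hrf0 j
    have hφ : 0 ≤ ∑ j ∈ (covered σ s)ᶜ, clusterCost X σ s j :=
      Finset.sum_nonneg fun j _ => hcl0 s j
    simp only [expCost, htot, seedBound, harmonic_zero, Rat.cast_zero, Nat.cast_zero, sub_zero]
    rcases eq_or_ne ((covered σ s)ᶜ.card) 0 with h | h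
    · rw [Finset.card_eq_zero] at h
      simp [h]
    · rw [div_self (by exact_mod_cast h)]
      linarith
  | succ t ih =>
    intro m hm s ht
    set S := covered σ s with hS
    set u : ℝ := (Sᶜ.card : ℝ) with hu
    set Φ := clusterCost X σ s with hΦ
    set φc := ∑ j ∈ S, Φ j with hφc
    set φu := ∑ j ∈ Sᶜ, Φ j with hφu
    set ou := ∑ j ∈ Sᶜ, refCost X σ c j with hou
    have hc0 : 0 ≤ φc := Finset.sum_nonneg fun j _ => hcl0 s j
    have hu0 : 0 ≤ φu := Finset.sum_nonneg fun j _ => hcl0 s j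
    have ho0 : 0 ≤ ou := Finset.sum_nonneg fun j _ => hrf0 j
    have htu : (t : ℝ) + 1 ≤ u := by rw [hu]; exact_mod_cast ht
    have ht0 : (0 : ℝ) ≤ t := t.cast_nonneg
    have hH0 := harmonic_cast_nonneg t
    have hH1 : ((harmonic (t + 1) : ℚ) : ℝ) = (harmonic t : ℝ) + 1 / (t + 1) := by
      rw [harmonic_succ]; push_cast; simp
    have htotal := htot s
    by_cases h0 : ∑ a, seedCost X s a = 0
    · rw [expCost_eq_zero X _ hm s h0]
      have := harmonic_cast_nonneg (t + 1)
      unfold seedBound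
      have : 0 ≤ (u - ((t + 1 : ℕ) : ℝ)) / u := by
        apply div_nonneg <;> push_cast <;> linarith
      positivity
    set φ := ∑ a, seedCost X s a with hφ
    have hφpos : 0 < φ := lt_of_le_of_ne (by linarith) (Ne.symm h0)
    have hφeq : φ = φc + φu := htotal
    -- the contribution of one cluster
    have hexp : φ * expCost X (t + 1) s
        = ∑ j, ∑ a with σ a = j, seedCost X s a * expCost X t (addSeed s a) := by
      rw [Finset.sum_fiberwise, expCost, Finset.mul_sum]
      refine Finset.sum_congr rfl fun a _ => ?_
      rw [nextProb, if_neg h0, ← mul_assoc, mul_div_cancel₀ _ h0]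
    have hcov : ∀ j ∈ S, ∑ a with σ a = j, seedCost X s a * expCost X t (addSeed s a)
        ≤ Φ j * seedBound t u φc φu ou := by
      intro j hj
      rw [hΦ, clusterCost, Finset.sum_mul]
      refine Finset.sum_le_sum fun a ha => mul_le_mul_of_nonneg_left ?_ (seedCost_nonneg _ _ _)
      have haj : σ a = j := by simpa using ha
      have hins : covered σ (addSeed s a) = S := by
        rw [covered_addSeed, haj, Finset.insert_eq_of_mem hj]
      have := ih (by omega) (addSeed s a) (by rw [hins]; omega)
      rw [hins] at this
      refine this.trans (seedBound_mono (by linarith) ?_ ?_) <;>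
      exact Finset.sum_le_sum fun j _ => Finset.sum_le_sum fun x _ => seedCost_addSeed_le hm X s a x
    have hunc : ∀ j ∈ Sᶜ, ∑ a with σ a = j, seedCost X s a * expCost X t (addSeed s a)
        ≤ Φ j * seedBound t (u - 1) φc (φu - Φ j) ou := by
      intro j hj
      have hjS : j ∉ S := by simpa using hj
      -- Covering j moves its new cost into the covered part and removes its reference cost from o;
      -- the second summand records the difference, to be averaged over a.
      have hstep : ∀ a ∈ Finset.univ.filter (fun a => σ a = j),
          seedCost X s a * expCost X t (addSeed s a) ≤
          seedCost X s a * (seedBound t (u - 1) φc (φu - Φ j) ou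
            + (clusterCost X σ (addSeed s a) j - 8 * refCost X σ c j) * (1 + (harmonic t : ℝ))) := by
        intro a ha
        refine mul_le_mul_of_nonneg_left ?_ (seedCost_nonneg _ _ _)
        have haj : σ a = j := by simpa using ha
        have hins : covered σ (addSeed s a) = insert j S := by rw [covered_addSeed, haj]
        have hcomp : (insert j S)ᶜ = Sᶜ.erase j := by
          ext i; simp
        have hcard : ((insert j S)ᶜ.card : ℝ) = u - 1 := by
          rw [hcomp, Finset.card_erase_of_mem hj, Nat.cast_sub (by omega)]
          simp [hu]
        have := ih (by omega) (addSeed s a) (by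
          rw [hins, hcomp, Finset.card_erase_of_mem hj]; omega)
        rw [hins, hcard, hcomp, Finset.sum_insert hjS] at this
        refine this.trans ?_
        have e1 : ∑ i ∈ S, clusterCost X σ (addSeed s a) i ≤ φc :=
          Finset.sum_le_sum fun j _ => Finset.sum_le_sum fun x _ =>
            seedCost_addSeed_le hm X s a x
        have e2 : ∑ i ∈ Sᶜ.erase j, clusterCost X σ (addSeed s a) i ≤ φu - Φ j := by
          have : φu - Φ j = ∑ i ∈ Sᶜ.erase j, Φ i := by
            rw [hφu, ← Finset.add_sum_erase _ _ hj]; ring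
          rw [this]
          exact Finset.sum_le_sum fun j _ => Finset.sum_le_sum fun x _ =>
            seedCost_addSeed_le hm X s a x
        have e3 : ∑ i ∈ Sᶜ.erase j, refCost X σ c i = ou - refCost X σ c j := by
          rw [hou, ← Finset.add_sum_erase _ _ hj]; ring
        rw [e3]
        refine (seedBound_mono (by linarith) (add_le_add le_rfl e1) e2).trans (le_of_eq ?_)
        unfold seedBound
        ring
      refine (Finset.sum_le_sum hstep).trans ?_
      have hD := sum_seedCost_mul_le hm X s (Finset.univ.filter fun a => σ a = j) (c j)
      have hsplit : ∑ a with σ a = j, seedCost X s a * (seedBound t (u - 1) φc (φu - Φ j) ou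
            + (clusterCost X σ (addSeed s a) j - 8 * refCost X σ c j) * (1 + (harmonic t : ℝ)))
          = Φ j * seedBound t (u - 1) φc (φu - Φ j) ou
            + (∑ a with σ a = j, seedCost X s a * clusterCost X σ (addSeed s a) j
              - 8 * Φ j * refCost X σ c j) * (1 + (harmonic t : ℝ)) := by
        have : ∀ a, seedCost X s a * (seedBound t (u - 1) φc (φu - Φ j) ou
            + (clusterCost X σ (addSeed s a) j - 8 * refCost X σ c j) * (1 + (harmonic t : ℝ)))
            = seedCost X s a * seedBound t (u - 1) φc (φu - Φ j) ou
            + (seedCost X s a * clusterCost X σ (addSeed s a) j) * (1 + (harmonic t : ℝ))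
            - seedCost X s a * (8 * refCost X σ c j * (1 + (harmonic t : ℝ))) := fun a => by ring
        simp only [this, Finset.sum_sub_distrib, Finset.sum_add_distrib, ← Finset.sum_mul]
        rw [hΦ, clusterCost]
        ring
      rw [hsplit]
      -- By D²-sampling, the recorded difference is nonpositive after averaging.
      have : (∑ a with σ a = j, seedCost X s a * clusterCost X σ (addSeed s a) j
          - 8 * Φ j * refCost X σ c j) * (1 + (harmonic t : ℝ)) ≤ 0 :=
        mul_nonpos_of_nonpos_of_nonneg (sub_nonpos.2 hD) (by linarith)
      linarith
    have hsum : φ * expCost X (t + 1) s ≤ φc * seedBound t u φc φu ou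
        + ∑ j ∈ Sᶜ, Φ j * seedBound t (u - 1) φc (φu - Φ j) ou := by
      rw [hexp, ← Finset.sum_add_sum_compl S, hφc, Finset.sum_mul]
      exact add_le_add (Finset.sum_le_sum hcov) (Finset.sum_le_sum hunc)
    -- Expensive uncovered clusters are hit more often: the average of the remaining cost φu - Φ j
    -- with weights Φ j is at most (1 - 1/u)φu, as for a uniform choice of j.
    have hpow : φu ^ 2 ≤ u * ∑ j ∈ Sᶜ, Φ j ^ 2 := sq_sum_le_card_mul_sum_sq
    have hsum2 : ∑ j ∈ Sᶜ, Φ j * seedBound t (u - 1) φc (φu - Φ j) ou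
        = φu * ((φc + 8 * ou) * (1 + (harmonic t : ℝ)))
          + (u - 1 - t) / (u - 1) * (φu ^ 2 - ∑ j ∈ Sᶜ, Φ j ^ 2) := by
      have : ∀ j, Φ j * seedBound t (u - 1) φc (φu - Φ j) ou
          = Φ j * ((φc + 8 * ou) * (1 + (harmonic t : ℝ)))
          + (u - 1 - t) / (u - 1) * (Φ j * φu - Φ j ^ 2) := fun j => by
        unfold seedBound; ring
      simp only [this, Finset.sum_add_distrib, ← Finset.mul_sum, Finset.sum_sub_distrib,
        ← Finset.sum_mul]
      rw [← hφu]
      ring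
    have hupos : 0 < u := by linarith
    have hsum3 : (u - 1 - t) / (u - 1) * (φu ^ 2 - ∑ j ∈ Sᶜ, Φ j ^ 2)
        ≤ (u - 1 - t) / u * φu ^ 2 := by
      rcases eq_or_lt_of_le (show 1 ≤ u by linarith) with h1 | h1
      · have : u - 1 - t = 0 := by linarith
        simp [this]
      · have h2 : φu ^ 2 - ∑ j ∈ Sᶜ, Φ j ^ 2 ≤ (u - 1) / u * φu ^ 2 := by
          have : φu ^ 2 / u ≤ ∑ j ∈ Sᶜ, Φ j ^ 2 := by
            rw [div_le_iff₀ hupos]; linarith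
          have e : (u - 1) / u * φu ^ 2 = φu ^ 2 - φu ^ 2 / u := by field_simp
          linarith
        refine (mul_le_mul_of_nonneg_left h2 (div_nonneg (by linarith) (by linarith))).trans
          (le_of_eq ?_)
        have : u - 1 ≠ 0 := by linarith
        field_simp
    have hfin : φ * expCost X (t + 1) s ≤ φ * seedBound (t + 1) u φc φu ou := by
      refine hsum.trans ?_
      rw [hsum2]
      unfold seedBound
      rw [hH1]
      push_cast
      -- Uses φu ≤ φ and t + 1 ≤ u.
      have hdiv : φc * φu / u ≤ φ * (φc / (t + 1)) := by
        calc φc * φu / u ≤ φc * φ / (t + 1) := by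
              gcongr
              linarith
          _ = φ * (φc / (t + 1)) := by ring
      have hdiv2 : 0 ≤ φ * (8 * ou / (t + 1)) := by positivity
      have e1 : φc * ((φc + 8 * ou) * (1 + (harmonic t : ℝ)) + (u - t) / u * φu)
          + (φu * ((φc + 8 * ou) * (1 + (harmonic t : ℝ))) + (u - 1 - t) / u * φu ^ 2)
          = φ * ((φc + 8 * ou) * (1 + (harmonic t : ℝ)) + (u - (t + 1)) / u * φu)
            + φc * φu / u := by
        rw [hφeq]; field_simp; ring
      have e2 : φ * ((φc + 8 * ou) * (1 + ((harmonic t : ℝ) + 1 / (t + 1)))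
            + (u - (t + 1)) / u * φu)
          = φ * ((φc + 8 * ou) * (1 + (harmonic t : ℝ)) + (u - (t + 1)) / u * φu)
            + φ * (φc / (t + 1)) + φ * (8 * ou / (t + 1)) := by ring
      linarith
    exact le_of_mul_le_mul_left hfin hφpos

/-- The expected cost of the k-means++ seeding is `O(log k)` times the cost of any centers. -/
theorem sum_kmeansppProb_objective_le {d n k : ℕ} (hk : 0 < k) (X : Fin n → Pt d)
    (C : Fin k → Pt d) :
    ∑ s : Fin k → Fin n, kmeansppProb X s * objective X (fun j => X (s j))
      ≤ 16 * (1 + Real.log k) * objective X C := by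
  choose σ hσ using fun a => exists_cost_eq hk C (X a)
  set O := ∑ j, refCost X σ C j with hO
  have hOC : O = ∑ a, cost C (X a) := by
    rw [hO, ← Finset.sum_fiberwise (g := σ)]
    refine Finset.sum_congr rfl fun j _ => Finset.sum_congr rfl fun a ha => ?_
    have : σ a = j := by simpa using ha
    rw [hσ, this]
  have hO0 : 0 ≤ O := by rw [hOC]; exact Finset.sum_nonneg fun _ _ => cost_nonneg _ _
  set H : ℝ := 1 + (harmonic (k - 1) : ℝ) with hH
  have hH0 : 0 ≤ H := by have := harmonic_cast_nonneg (k - 1); linarith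
  have hstate : ∀ a, expCost X (k - 1) (fun _ : Fin 1 => a) ≤
      ((clusterCost X σ (fun _ : Fin 1 => a) (σ a) - 8 * refCost X σ C (σ a)) + 8 * O) * H := by
    intro a
    have hcov : covered σ (fun _ : Fin 1 => a) = {σ a} := by
      ext; simp [covered]
    have hcard : ({σ a} : Finset (Fin k))ᶜ.card = k - 1 := by
      rw [Finset.card_compl]; simp
    have := expCost_le_seedBound X σ C (k - 1) one_pos (fun _ : Fin 1 => a)
      (by rw [hcov, hcard])
    rw [hcov, hcard] at this
    refine this.trans (le_of_eq ?_)
    have e : ∑ j ∈ ({σ a} : Finset (Fin k))ᶜ, refCost X σ C j = O - refCost X σ C (σ a) := by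
      rw [hO, ← Finset.sum_add_sum_compl {σ a}, Finset.sum_singleton]; ring
    -- Here t = u = k - 1, so the uncovered cost has coefficient 0.
    rw [seedBound, sub_self, e, Finset.sum_singleton]
    ring
  -- The first seed is uniform, so within a cluster its average cost is at most 2, hence at most 8,
  -- times the reference cost.
  have hfirst : ∑ a, (clusterCost X σ (fun _ : Fin 1 => a) (σ a) - 8 * refCost X σ C (σ a)) ≤ 0 := by
    rw [← Finset.sum_fiberwise (g := σ)]
    refine Finset.sum_nonpos fun j _ => ?_
    have h1 := sum_sum_norm_sub_sq_le X (Finset.univ.filter fun a => σ a = j) (C j)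
    have h2 : ∑ a with σ a = j, (clusterCost X σ (fun _ : Fin 1 => a) (σ a)
        - 8 * refCost X σ C (σ a))
        = ∑ a with σ a = j, ∑ x with σ x = j, ‖X x - X a‖ ^ 2
          - 8 * (Finset.univ.filter fun a => σ a = j).card * refCost X σ C j := by
      rw [mul_comm (8 : ℝ), mul_assoc, ← nsmul_eq_mul, ← Finset.sum_const,
        ← Finset.sum_sub_distrib]
      refine Finset.sum_congr rfl fun a ha => ?_
      have haj : σ a = j := by simpa using ha
      simp [haj, clusterCost, seedCost, cost]
    rw [h2]
    have h3 : 0 ≤ ((Finset.univ.filter fun a => σ a = j).card : ℝ) * refCost X σ C j :=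
      mul_nonneg (Nat.cast_nonneg _) (Finset.sum_nonneg fun _ _ => sq_nonneg _)
    have h4 : refCost X σ C j = ∑ a with σ a = j, ‖X a - C j‖ ^ 2 := rfl
    rw [← h4] at h1
    nlinarith
  have hobj : ∑ s : Fin k → Fin n, kmeansppProb X s * objective X (fun j => X (s j))
      = 1 / (n : ℝ) * (1 / (n : ℝ) * ∑ a, expCost X (k - 1) (fun _ : Fin 1 => a)) := by
    rw [← sum_kmeansppProb_eq hk X, Finset.mul_sum]
    refine Finset.sum_congr rfl fun s _ => ?_
    simp only [objective, expCost, seedCost]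
    ring
  have hsum : ∑ a, expCost X (k - 1) (fun _ : Fin 1 => a) ≤ n * (8 * O * H) := by
    refine (Finset.sum_le_sum fun a _ => hstate a).trans ?_
    rw [← Finset.sum_mul, Finset.sum_add_distrib]
    simp only [Finset.sum_const, Finset.card_univ, Fintype.card_fin, nsmul_eq_mul]
    nlinarith [mul_nonneg (neg_nonneg.2 hfirst) hH0]
  have hHle : H ≤ 2 * (1 + Real.log k) := by
    have h1 := harmonic_le_one_add_log (k - 1)
    have h2 : Real.log ((k - 1 : ℕ) : ℝ) ≤ Real.log k := by
      rcases Nat.eq_zero_or_pos (k - 1) with h | h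
      · rw [h]; simpa using Real.log_natCast_nonneg k
      · exact Real.log_le_log (by exact_mod_cast h) (by exact_mod_cast Nat.sub_le k 1)
    have h3 := Real.log_natCast_nonneg k
    rw [hH]
    linarith
  rw [hobj, objective, ← hOC]
  have hn : 1 / (n : ℝ) * ∑ a, expCost X (k - 1) (fun _ : Fin 1 => a) ≤ 8 * O * H := by
    rcases Nat.eq_zero_or_pos n with h | h
    · subst h
      simp; positivity
    · have : (0 : ℝ) < n := by exact_mod_cast h
      rw [one_div, inv_mul_le_iff₀ this]
      exact hsum
  calc 1 / (n : ℝ) * (1 / (n : ℝ) * ∑ a, expCost X (k - 1) (fun _ : Fin 1 => a))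
      ≤ 1 / (n : ℝ) * (8 * O * (2 * (1 + Real.log k))) :=
        mul_le_mul_of_nonneg_left (hn.trans (by gcongr)) (by positivity)
    _ = 16 * (1 + Real.log k) * (1 / (n : ℝ) * O) := by ring

end MiniBatchKMeans

/-! ### Moments and concentration of batch averages. -/

namespace MiniBatchKMeans

/-! ### Averages over all batches -/

/-- The average of `F` over all batches of size `b`. -/
noncomputable def batchMean {n b : ℕ} (F : (Fin b → Fin n) → ℝ) : ℝ :=
  1 / (n : ℝ) ^ b * ∑ β, F β

theorem batchMean_mono {n b : ℕ} {F G : (Fin b → Fin n) → ℝ} (h : ∀ β, F β ≤ G β) :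
    batchMean F ≤ batchMean G :=
  mul_le_mul_of_nonneg_left (Finset.sum_le_sum fun β _ => h β) (by positivity)

theorem batchMean_nonneg {n b : ℕ} {F : (Fin b → Fin n) → ℝ} (h : ∀ β, 0 ≤ F β) :
    0 ≤ batchMean F :=
  mul_nonneg (by positivity) (Finset.sum_nonneg fun β _ => h β)

theorem batchMean_add {n b : ℕ} (F G : (Fin b → Fin n) → ℝ) :
    batchMean (fun β => F β + G β) = batchMean F + batchMean G := by
  simp only [batchMean, Finset.sum_add_distrib, mul_add]

theorem batchMean_const_mul {n b : ℕ} (c : ℝ) (F : (Fin b → Fin n) → ℝ) :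
    batchMean (fun β => c * F β) = c * batchMean F := by
  simp only [batchMean, ← Finset.mul_sum]
  ring

theorem batchMean_const {n b : ℕ} (hn : 0 < n) (c : ℝ) :
    batchMean (fun _ : Fin b → Fin n => c) = c := by
  have : (n : ℝ) ≠ 0 := by exact_mod_cast hn.ne'
  simp [batchMean, this]

theorem sum_batch_succ {n b : ℕ} (F : (Fin (b + 1) → Fin n) → ℝ) :
    ∑ β, F β = ∑ a, ∑ β : Fin b → Fin n, F (Fin.cons a β) := by
  rw [← (Fin.consEquiv (fun _ => Fin n)).sum_comp, Fintype.sum_prod_type]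
  rfl

theorem sum_batch_sum {n : ℕ} (g : Fin n → ℝ) (b : ℕ) :
    n * ∑ β : Fin b → Fin n, ∑ l, g (β l) = b * n ^ b * ∑ a, g a := by
  induction b with
  | zero => simp
  | succ b ih =>
    rw [sum_batch_succ]
    simp only [Fin.sum_univ_succ, Fin.cons_zero, Fin.cons_succ, Finset.sum_add_distrib,
      Finset.sum_const, Finset.card_univ, Fintype.card_fun, Fintype.card_fin, nsmul_eq_mul,
      ← Finset.mul_sum, Nat.cast_pow]
    rw [mul_add, ih]
    push_cast
    ring

theorem sum_batch_sum_sq {n : ℕ} (g : Fin n → ℝ) (hg : ∑ a, g a = 0) (b : ℕ) :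
    n * ∑ β : Fin b → Fin n, (∑ l, g (β l)) ^ 2 = b * n ^ b * ∑ a, g a ^ 2 := by
  induction b with
  | zero => simp
  | succ b ih =>
    rw [sum_batch_succ]
    simp only [Fin.sum_univ_succ, Fin.cons_zero, Fin.cons_succ, add_sq, Finset.sum_add_distrib,
      Finset.sum_const, Finset.card_univ, Fintype.card_fun, Fintype.card_fin, nsmul_eq_mul,
      ← Finset.mul_sum, ← Finset.sum_mul, Nat.cast_pow, hg]
    rw [mul_add, ih]
    push_cast
    ring

theorem batchMean_objective {d n k b : ℕ} (hn : 0 < n) (hb : 0 < b) (X : Fin n → Pt d)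
    (C : Fin k → Pt d) :
    batchMean (fun β : Fin b → Fin n => objective (fun l => X (β l)) C) = objective X C := by
  have hn' : (n : ℝ) ≠ 0 := by exact_mod_cast hn.ne'
  have hb' : (b : ℝ) ≠ 0 := by exact_mod_cast hb.ne'
  have h := sum_batch_sum (fun a => cost C (X a)) b
  unfold batchMean objective
  rw [← Finset.mul_sum]
  have h2 : ∑ β : Fin b → Fin n, ∑ l, cost C (X (β l))
      = b * n ^ b * (∑ a, cost C (X a)) / n := by
    rw [← h]; field_simp
  rw [h2]
  field_simp

/-- The variance of one sample is at most its second moment, and cost² ≤ M · cost. The bound is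
proportional to the objective itself, which is what makes it usable when the objective is tiny. -/
theorem batchMean_sq_sub_le {d n k b : ℕ} (hn : 0 < n) (hb : 0 < b) (X : Fin n → Pt d)
    (C : Fin k → Pt d) {M : ℝ} (hM : ∀ a, cost C (X a) ≤ M) :
    batchMean (fun β : Fin b → Fin n =>
      (objective (fun l => X (β l)) C - objective X C) ^ 2) ≤ M * objective X C / b := by
  have hn0 : (0 : ℝ) < n := by exact_mod_cast hn
  have hb0 : (0 : ℝ) < b := by exact_mod_cast hb
  set f := objective X C with hf
  have hfs : ∑ a, cost C (X a) = n * f := by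
    rw [hf, objective]; field_simp
  set g : Fin n → ℝ := fun a => cost C (X a) - f with hg
  have hg0 : ∑ a, g a = 0 := by
    simp [hg, Finset.sum_sub_distrib, hfs]
  have h := sum_batch_sum_sq g hg0 b
  have h1 : ∀ β : Fin b → Fin n, (objective (fun l => X (β l)) C - f) ^ 2
      = 1 / (b : ℝ) ^ 2 * (∑ l, g (β l)) ^ 2 := fun β => by
    simp only [hg, Finset.sum_sub_distrib, objective, Finset.sum_const, Finset.card_univ,
      Fintype.card_fin, nsmul_eq_mul]
    field_simp
  have h2 : ∑ β : Fin b → Fin n, (∑ l, g (β l)) ^ 2 = b * n ^ b * (∑ a, g a ^ 2) / n := by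
    rw [← h]; field_simp
  have h3 : ∑ a, g a ^ 2 ≤ n * (M * f) := by
    have : ∑ a, g a ^ 2 = ∑ a, cost C (X a) ^ 2 - n * f ^ 2 := by
      simp only [hg, sub_sq, Finset.sum_add_distrib, Finset.sum_sub_distrib, ← Finset.mul_sum,
        ← Finset.sum_mul, hfs, Finset.sum_const, Finset.card_univ, Fintype.card_fin, nsmul_eq_mul]
      ring
    rw [this]
    have h4 : ∑ a, cost C (X a) ^ 2 ≤ M * (n * f) := by
      rw [← hfs, Finset.mul_sum]
      refine Finset.sum_le_sum fun a _ => ?_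
      nlinarith [hM a, cost_nonneg C (X a)]
    nlinarith [sq_nonneg f]
  unfold batchMean
  simp only [h1, ← Finset.mul_sum, h2]
  calc 1 / (n : ℝ) ^ b * (1 / (b : ℝ) ^ 2 * (b * n ^ b * (∑ a, g a ^ 2) / n))
      = (∑ a, g a ^ 2) / (n * b) := by field_simp
    _ ≤ n * (M * f) / (n * b) := by gcongr
    _ = M * f / b := by field_simp

/-! ### Concentration of batch averages -/

open Classical in
-- Bernstein's inequality by the exponential moment method, with exp x ≤ 1 + x + x² for |x| ≤ 1. The
-- parameter λ = √(r/W) balances λ²W = r against λ · 2√(Wr) = 2r; the condition r ≤ W ensures λ ≤ 1.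
theorem batchMean_tail {n b : ℕ} (hn : 0 < n) (hb : 0 < b) (z : Fin n → ℝ) {W r : ℝ}
    (hz : ∀ a, |z a| ≤ 1) (hW : 1 / (n : ℝ) * ∑ a, z a ^ 2 ≤ W) (hr : 0 < r) (hrW : r ≤ W) :
    batchMean (fun β : Fin b → Fin n =>
      if 2 * √(W * r) ≤ 1 / (b : ℝ) * ∑ l, z (β l) - 1 / (n : ℝ) * ∑ a, z a then (1 : ℝ) else 0)
      ≤ Real.exp (-(b * r)) := by
  have hn0 : (0 : ℝ) < n := by exact_mod_cast hn
  have hb0 : (0 : ℝ) < b := by exact_mod_cast hb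
  have hW0 : 0 < W := hr.trans_le hrW
  set m := 1 / (n : ℝ) * ∑ a, z a with hm
  set lam := √(r / W) with hlam
  have hlam0 : 0 ≤ lam := Real.sqrt_nonneg _
  have hlam1 : lam ≤ 1 := by
    rw [hlam, Real.sqrt_le_one]
    exact (div_le_one hW0).2 hrW
  have hlam2 : lam ^ 2 * W = r := by
    rw [hlam, Real.sq_sqrt (by positivity)]; field_simp
  have hlam3 : lam * √(W * r) = r := by
    rw [hlam, ← Real.sqrt_mul (by positivity)]
    have : r / W * (W * r) = r ^ 2 := by field_simp
    rw [this, Real.sqrt_sq hr.le]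
  have hmgf : ∑ a, Real.exp (lam * z a) ≤ n * Real.exp (lam * m + r) := by
    have h1 : ∀ a, Real.exp (lam * z a) ≤ 1 + lam * z a + lam ^ 2 * z a ^ 2 := fun a => by
      have h := Real.abs_exp_sub_one_sub_id_le (x := lam * z a) (by
        rw [abs_mul, abs_of_nonneg hlam0]
        nlinarith [hz a, abs_nonneg (z a)])
      have := (abs_le.1 h).2
      nlinarith
    have h2 : ∑ a, z a = n * m := by rw [hm]; field_simp
    have h3 : ∑ a, z a ^ 2 ≤ n * W := by
      rw [one_div, inv_mul_le_iff₀ hn0] at hW; exact hW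
    calc ∑ a, Real.exp (lam * z a) ≤ ∑ a, (1 + lam * z a + lam ^ 2 * z a ^ 2) :=
          Finset.sum_le_sum fun a _ => h1 a
      _ = n + lam * (n * m) + lam ^ 2 * ∑ a, z a ^ 2 := by
          simp [Finset.sum_add_distrib, ← Finset.mul_sum, h2]
      _ ≤ n + lam * (n * m) + lam ^ 2 * (n * W) := by gcongr
      _ = n * (lam * m + r + 1) := by rw [← hlam2]; ring
      _ ≤ n * Real.exp (lam * m + r) := by gcongr; exact Real.add_one_le_exp _
  have hpt : ∀ β : Fin b → Fin n,
      (if 2 * √(W * r) ≤ 1 / (b : ℝ) * ∑ l, z (β l) - m then (1 : ℝ) else 0)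
        ≤ Real.exp (-(b * (lam * m + 2 * r))) * ∏ l, Real.exp (lam * z (β l)) := by
    intro β
    rw [← Real.exp_sum, ← Real.exp_add]
    split_ifs with h
    · rw [Real.one_le_exp_iff, ← Finset.mul_sum]
      have h1 : (b : ℝ) * (2 * √(W * r) + m) ≤ ∑ l, z (β l) := by
        calc (b : ℝ) * (2 * √(W * r) + m) ≤ b * (1 / (b : ℝ) * ∑ l, z (β l)) := by
              gcongr; linarith
          _ = ∑ l, z (β l) := by field_simp
      have h2 := mul_le_mul_of_nonneg_left h1 hlam0
      have h3 : lam * (b * (2 * √(W * r) + m)) = b * (lam * m + 2 * r) := by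
        linear_combination (2 * (b : ℝ)) * hlam3
      linarith
    · exact (Real.exp_pos _).le
  refine (batchMean_mono hpt).trans ?_
  have hpow : ∑ β : Fin b → Fin n, ∏ l, Real.exp (lam * z (β l))
      = (∑ a, Real.exp (lam * z a)) ^ b := (Fintype.sum_pow (fun a => Real.exp (lam * z a)) b).symm
  rw [batchMean_const_mul, batchMean, hpow]
  calc Real.exp (-(b * (lam * m + 2 * r))) * (1 / (n : ℝ) ^ b * (∑ a, Real.exp (lam * z a)) ^ b)
      ≤ Real.exp (-(b * (lam * m + 2 * r)))
          * (1 / (n : ℝ) ^ b * (n * Real.exp (lam * m + r)) ^ b) := by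
        gcongr
    _ = Real.exp (-(b * (lam * m + 2 * r))) * Real.exp (b * (lam * m + r)) := by
        rw [mul_pow, ← Real.exp_nat_mul]; field_simp
    _ = Real.exp (-(b * r)) := by rw [← Real.exp_add]; congr 1; ring

open Classical in
theorem batchMean_exists_le {n b : ℕ} {ι : Type*} [Fintype ι] (p : ι → (Fin b → Fin n) → Prop)
    {e : ℝ} (h : ∀ i, batchMean (fun β => if p i β then (1 : ℝ) else 0) ≤ e) :
    batchMean (fun β => if ∃ i, p i β then (1 : ℝ) else 0) ≤ Fintype.card ι * e := by
  have h1 : batchMean (fun β => if ∃ i, p i β then (1 : ℝ) else 0)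
      ≤ batchMean (fun β => ∑ i, if p i β then (1 : ℝ) else 0) := by
    refine batchMean_mono fun β => ?_
    have h0 : ∀ i ∈ Finset.univ, (0 : ℝ) ≤ if p i β then (1 : ℝ) else 0 := fun i _ => by
      split_ifs <;> norm_num
    split_ifs with hex
    · obtain ⟨i, hi⟩ := hex
      have := Finset.single_le_sum h0 (Finset.mem_univ i)
      rwa [if_pos hi] at this
    · exact Finset.sum_nonneg h0
  have h2 : batchMean (fun β => ∑ i, if p i β then (1 : ℝ) else 0)
      = ∑ i, batchMean (fun β => if p i β then (1 : ℝ) else 0) := by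
    simp only [batchMean, ← Finset.mul_sum]
    rw [Finset.sum_comm]
  refine h1.trans (h2.le.trans ((Finset.sum_le_sum fun i _ => h i).trans ?_))
  simp

open Classical in
theorem batchMean_exists_abs_le {n b : ℕ} (hn : 0 < n) (hb : 0 < b) {ι : Type*} [Fintype ι]
    (z : ι → Fin n → ℝ) (W : ι → ℝ) {r : ℝ} (hz : ∀ i a, |z i a| ≤ 1)
    (hW : ∀ i, 1 / (n : ℝ) * ∑ a, z i a ^ 2 ≤ W i) (hr : 0 < r) (hrW : ∀ i, r ≤ W i) :
    batchMean (fun β : Fin b → Fin n =>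
      if ∃ i, 2 * √(W i * r) ≤ |1 / (b : ℝ) * ∑ l, z i (β l) - 1 / (n : ℝ) * ∑ a, z i a|
        then (1 : ℝ) else 0) ≤ 2 * Fintype.card ι * Real.exp (-(b * r)) := by
  -- The Boolean selects the sign, which makes the one-sided tail bound two-sided.
  have h := batchMean_exists_le (ι := ι × Bool) (fun i (β : Fin b → Fin n) =>
      2 * √(W i.1 * r) ≤ 1 / (b : ℝ) * ∑ l, (if i.2 then z i.1 (β l) else - z i.1 (β l))
        - 1 / (n : ℝ) * ∑ a, (if i.2 then z i.1 a else - z i.1 a)) (fun i =>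
      batchMean_tail hn hb (fun a => if i.2 then z i.1 a else - z i.1 a)
        (fun a => by split_ifs <;> simp [hz])
        (by
          refine le_trans (le_of_eq ?_) (hW i.1)
          congr 1
          exact Finset.sum_congr rfl fun a _ => by split_ifs <;> simp) hr (hrW i.1))
  rw [Fintype.card_prod, Fintype.card_bool] at h
  push_cast at h
  rw [mul_comm (2 : ℝ)]
  refine le_trans (batchMean_mono fun β => ?_) h
  by_cases hex : ∃ i, 2 * √(W i * r) ≤ |1 / (b : ℝ) * ∑ l, z i (β l) - 1 / (n : ℝ) * ∑ a, z i a|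
  · rw [if_pos hex, if_pos]
    obtain ⟨i, hi⟩ := hex
    rcases le_abs.1 hi with h1 | h1
    · exact ⟨(i, true), by simpa using h1⟩
    · refine ⟨(i, false), ?_⟩
      simp only [Bool.false_eq_true, if_false, Finset.sum_neg_distrib]
      linarith
  · rw [if_neg hex]
    split_ifs <;> norm_num

/-- If w ≥ r, the difference splits into (S - M)/√w and (S/√v)(√w - √v)/√w, each at most 2√r; for
the second, |S/√v| ≤ √v and √v · |√w - √v| ≤ |v - w|. If w < r, both quotients are small by
themselves, being at most √v ≤ 2√r and √w ≤ √r. -/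
theorem abs_div_sqrt_sub_div_sqrt_le {S M v w r : ℝ} (hr : 0 < r) (hS : |S| ≤ v) (hM : |M| ≤ w)
    (h1 : |S - M| ≤ 2 * √(max w r * r)) (h2 : |v - w| ≤ 2 * √(max w r * r)) :
    |S / √v - M / √w| ≤ 4 * √r := by
  have hv0 : 0 ≤ v := (abs_nonneg _).trans hS
  have hw0 : 0 ≤ w := (abs_nonneg _).trans hM
  have hsr : 0 < √r := Real.sqrt_pos.2 hr
  set p := √v with hp
  set q := √w with hq
  have hp0 : 0 ≤ p := Real.sqrt_nonneg _
  have hq0 : 0 ≤ q := Real.sqrt_nonneg _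
  have hpv : p * p = v := Real.mul_self_sqrt hv0
  have hqw : q * q = w := Real.mul_self_sqrt hw0
  have hSp : |S / p| ≤ p := by
    rw [abs_div, abs_of_nonneg hp0]
    exact div_le_of_le_mul₀ hp0 hp0 (by rw [hpv]; exact hS)
  have hMq : |M / q| ≤ q := by
    rw [abs_div, abs_of_nonneg hq0]
    exact div_le_of_le_mul₀ hq0 hq0 (by rw [hqw]; exact hM)
  rcases le_or_gt r w with hrw | hrw
  · rw [max_eq_left hrw, Real.sqrt_mul hw0, ← hq] at h1 h2
    have hqpos : 0 < q := Real.sqrt_pos.2 (hr.trans_le hrw)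
    have e1 : |(S - M) / q| ≤ 2 * √r := by
      rw [abs_div, abs_of_pos hqpos, div_le_iff₀ hqpos]
      linarith
    have e2 : |S / p * (q - p) / q| ≤ 2 * √r := by
      rw [abs_div, abs_of_pos hqpos, div_le_iff₀ hqpos, abs_mul]
      have : |v - w| = |q - p| * (p + q) := by
        rw [← hpv, ← hqw, show p * p - q * q = -((q - p) * (p + q)) by ring, abs_neg, abs_mul,
          abs_of_nonneg (add_nonneg hp0 hq0)]
      nlinarith [abs_nonneg (q - p), mul_le_mul_of_nonneg_right hSp (abs_nonneg (q - p)),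
        mul_nonneg (abs_nonneg (q - p)) hq0]
    -- For p = 0 also S = 0, and the identity survives with the convention S / 0 = 0.
    have e3 : S / p - M / q = (S - M) / q + S / p * (q - p) / q := by
      rcases eq_or_lt_of_le hp0 with h | h
      · have : S = 0 := by
          have : v = 0 := by rw [← hpv, ← h]; ring
          rw [this] at hS
          exact abs_eq_zero.1 (le_antisymm hS (abs_nonneg _))
        rw [this]; simp [neg_div]
      · field_simp
        ring
    rw [e3]
    exact (abs_add_le _ _).trans (by linarith)
  · rw [max_eq_right hrw.le, Real.sqrt_mul_self hr.le] at h1 h2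
    have hv : v ≤ r * 4 := by linarith [(abs_le.1 h2).2]
    have e1 : p ≤ 2 * √r := by
      rw [hp, Real.sqrt_le_left (by positivity), mul_pow, Real.sq_sqrt hr.le]
      linarith
    have e2 : q ≤ √r := Real.sqrt_le_sqrt hrw.le
    exact (abs_sub _ _).trans (by linarith)

end MiniBatchKMeans

/-! ### Geometry of one update, and good batches. -/

namespace MiniBatchKMeans

/-! ### Centers in the cube -/

/-- All centers lie in the unit cube. -/
def InCube {d k : ℕ} (C : Fin k → Pt d) : Prop := ∀ j c, C j c ∈ Set.Icc (0 : ℝ) 1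

theorem norm_sub_sq_le_dim {d : ℕ} {x y : Pt d} (hx : ∀ c, x c ∈ Set.Icc (0 : ℝ) 1)
    (hy : ∀ c, y c ∈ Set.Icc (0 : ℝ) 1) : ‖x - y‖ ^ 2 ≤ d := by
  rw [EuclideanSpace.real_norm_sq_eq]
  calc ∑ c, (x - y) c ^ 2 ≤ ∑ _c : Fin d, (1 : ℝ) := by
        refine Finset.sum_le_sum fun c _ => ?_
        have h1 := hx c
        have h2 := hy c
        rw [PiLp.sub_apply, sq_le_one_iff_abs_le_one, abs_le]
        constructor <;> linarith [h1.1, h1.2, h2.1, h2.2]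
    _ = d := by simp

theorem cost_le_dim {d k : ℕ} (hk : 0 < k) {C : Fin k → Pt d} (hC : InCube C) {x : Pt d}
    (hx : ∀ c, x c ∈ Set.Icc (0 : ℝ) 1) : cost C x ≤ d :=
  (cost_le C x ⟨0, hk⟩).trans (norm_sub_sq_le_dim hx (hC _))

theorem objective_mono {d k k' l : ℕ} (A : Fin l → Pt d) {C : Fin k → Pt d} {C' : Fin k' → Pt d}
    {q : ℝ} (hl : 0 < l) (h : ∀ i, cost C (A i) ≤ cost C' (A i) + q) :
    objective A C ≤ objective A C' + q := by
  have hl' : (0 : ℝ) < l := by exact_mod_cast hl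
  have h1 : ∑ i, cost C (A i) ≤ ∑ i, cost C' (A i) + l * q := by
    refine (Finset.sum_le_sum fun i _ => h i).trans (le_of_eq ?_)
    simp [Finset.sum_add_distrib]
  unfold objective
  calc 1 / (l : ℝ) * ∑ i, cost C (A i) ≤ 1 / (l : ℝ) * (∑ i, cost C' (A i) + l * q) := by gcongr
    _ = _ := by field_simp

theorem objective_le_of_cost_le {d k l : ℕ} (A : Fin l → Pt d) {C : Fin k → Pt d} {q : ℝ}
    (hq : 0 ≤ q) (h : ∀ i, cost C (A i) ≤ q) : objective A C ≤ q := by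
  unfold objective
  rw [one_div]
  refine inv_mul_le_of_le_mul₀ (Nat.cast_nonneg _) hq ?_
  refine (Finset.sum_le_sum fun i _ => h i).trans (le_of_eq ?_)
  simp

variable {d n k b : ℕ} {X : Fin n → Pt d} {τ : (Fin k → Pt d) → Fin n → Fin k}

theorem rate_mem_Icc (C : Fin k → Pt d) (β : Fin b → Fin n) (j : Fin k) :
    rate τ C β j ∈ Set.Icc (0 : ℝ) 1 := by
  refine ⟨Real.sqrt_nonneg _, ?_⟩
  rw [rate, Real.sqrt_le_one]
  refine div_le_one_of_le₀ ?_ (Nat.cast_nonneg _)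
  exact_mod_cast (Finset.card_le_univ _).trans (by simp)

theorem update_mem_cube (hX : ∀ a c, X a c ∈ Set.Icc (0 : ℝ) 1) {C : Fin k → Pt d} (hC : InCube C)
    (β : Fin b → Fin n) : InCube (update X τ C β) := by
  intro j c
  obtain ⟨h0, h1⟩ := rate_mem_Icc (τ := τ) C β j
  have hm : centerOfMass X β (part τ C β j) c ∈ Set.Icc (0 : ℝ) 1 := by
    have e : centerOfMass X β (part τ C β j) c
        = ((part τ C β j).card : ℝ)⁻¹ * ∑ l ∈ part τ C β j, X (β l) c := by
      simp [centerOfMass]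
    rw [e]
    refine ⟨mul_nonneg (by positivity) (Finset.sum_nonneg fun l _ => (hX _ c).1), ?_⟩
    refine inv_mul_le_of_le_mul₀ (Nat.cast_nonneg _) zero_le_one ?_
    refine (Finset.sum_le_sum fun l _ => (hX (β l) c).2).trans (le_of_eq ?_)
    simp
  have hc := hC j c
  simp only [update, PiLp.add_apply, PiLp.smul_apply, smul_eq_mul, Set.mem_Icc] at hc hm ⊢
  constructor <;> nlinarith [mul_le_mul_of_nonneg_left hm.2 h0,
    mul_le_mul_of_nonneg_left hc.2 (sub_nonneg.2 h1), mul_nonneg h0 hm.1,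
    mul_nonneg (sub_nonneg.2 h1) hc.1]

/-! ### The displacement of a center -/

/-- The fraction of the batch assigned to the `j`-th center. -/
noncomputable def weight (τ : (Fin k → Pt d) → Fin n → Fin k) (C : Fin k → Pt d)
    (β : Fin b → Fin n) (j : Fin k) : ℝ := ((part τ C β j).card : ℝ) / b

theorem weight_nonneg (C : Fin k → Pt d) (β : Fin b → Fin n) (j : Fin k) :
    0 ≤ weight τ C β j := by unfold weight; positivity

theorem sqrt_weight_le_one (C : Fin k → Pt d) (β : Fin b → Fin n) (j : Fin k) :
    √(weight τ C β j) ≤ 1 := (rate_mem_Icc (τ := τ) C β j).2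

/-- Separates the displacement into a plain batch average, to which concentration applies, and the
normalization by the square root of the weight. For an empty part both sides vanish. -/
theorem update_sub (C : Fin k → Pt d) (β : Fin b → Fin n) (j : Fin k) :
    update X τ C β j - C j = (1 / √(weight τ C β j)) •
      ((1 / (b : ℝ)) • ∑ l ∈ part τ C β j, (X (β l) - C j)) := by
  have h1 : update X τ C β j - C j
      = √(weight τ C β j) • (centerOfMass X β (part τ C β j) - C j) := by
    simp only [update, rate, weight]
    module
  rw [h1]
  rcases (part τ C β j).eq_empty_or_nonempty with h | h
  · simp [weight, h]
  have hN : (0 : ℝ) < (part τ C β j).card := by exact_mod_cast h.card_pos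
  have hb : (0 : ℝ) < b := by
    obtain ⟨l, -⟩ := h
    exact_mod_cast l.pos
  have hw : 0 < weight τ C β j := by unfold weight; positivity
  have hs : 0 < √(weight τ C β j) := Real.sqrt_pos.2 hw
  have h2 : centerOfMass X β (part τ C β j) - C j
      = (1 / ((part τ C β j).card : ℝ)) • ∑ l ∈ part τ C β j, (X (β l) - C j) := by
    rw [Finset.sum_sub_distrib, smul_sub, Finset.sum_const, ← Nat.cast_smul_eq_nsmul ℝ, smul_smul,
      one_div, inv_mul_cancel₀ hN.ne', one_smul, centerOfMass, one_div]
  rw [h2, smul_smul, smul_smul]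
  congr 1
  have h3 : √(weight τ C β j) * √(weight τ C β j) = (part τ C β j).card / b :=
    Real.mul_self_sqrt hw.le
  field_simp
  rw [sq, h3]
  field_simp

theorem inner_update_sub (C : Fin k → Pt d) (β : Fin b → Fin n) (j : Fin k) (y : Pt d) :
    inner ℝ y (update X τ C β j - C j) = (1 / (b : ℝ) * ∑ l ∈ part τ C β j,
      inner ℝ y (X (β l) - C j)) / √(weight τ C β j) := by
  rw [update_sub, inner_smul_right, inner_smul_right, inner_sum]
  ring

/-- The displacement is √w times an average of vectors `X a - C j`, and √w ≤ 1. -/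
theorem abs_inner_update_sub_le (C : Fin k → Pt d) (β : Fin b → Fin n) (j : Fin k) (y : Pt d)
    {q : ℝ} (hq : 0 ≤ q) (h : ∀ a, |inner ℝ y (X a - C j)| ≤ q) :
    |inner ℝ y (update X τ C β j - C j)| ≤ q := by
  have h1 : |1 / (b : ℝ) * ∑ l ∈ part τ C β j, inner ℝ y (X (β l) - C j)|
      ≤ weight τ C β j * q := by
    rw [abs_mul, abs_of_nonneg (by positivity : (0 : ℝ) ≤ 1 / b), weight]
    calc 1 / (b : ℝ) * |∑ l ∈ part τ C β j, inner ℝ y (X (β l) - C j)|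
        ≤ 1 / (b : ℝ) * ((part τ C β j).card * q) := by
          gcongr
          refine (Finset.abs_sum_le_sum_abs _ _).trans
            ((Finset.sum_le_sum fun l _ => h (β l)).trans (le_of_eq ?_))
          simp
      _ = _ := by ring
  rw [inner_update_sub, abs_div, abs_of_nonneg (Real.sqrt_nonneg _)]
  refine div_le_of_le_mul₀ (Real.sqrt_nonneg _) hq (h1.trans ?_)
  have h2 := Real.mul_self_sqrt (weight_nonneg (τ := τ) C β j)
  have h3 := sqrt_weight_le_one (τ := τ) C β j
  have h4 := Real.sqrt_nonneg (weight τ C β j)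
  nlinarith [mul_nonneg hq (mul_nonneg h4 (sub_nonneg.2 h3))]

/-- If the displacements for two batches are close in all directions `X a - C j`, then so are the
costs of the data points after the updates. -/
theorem cost_update_le {b' : ℕ} (hk : 0 < k) (C : Fin k → Pt d) (β : Fin b → Fin n)
    (β' : Fin b' → Fin n) {q : ℝ}
    (h : ∀ j a, |inner ℝ (X a - C j) (update X τ C β j - C j)
      - inner ℝ (X a - C j) (update X τ C β' j - C j)| ≤ q) (a : Fin n) :
    cost (update X τ C β) (X a) ≤ cost (update X τ C β') (X a) + 4 * q := by
  obtain ⟨j, hj⟩ := exists_cost_eq hk (update X τ C β') (X a)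
  have hq : 0 ≤ q := (abs_nonneg _).trans (h j a)
  rw [hj]
  refine (cost_le _ _ j).trans ?_
  set U := update X τ C β j - C j with hU
  set V := update X τ C β' j - C j with hV
  have h' : ∀ a, |inner ℝ (U - V) (X a - C j)| ≤ q := fun a => by
    rw [real_inner_comm, inner_sub_right]
    exact h j a
  have e1 := abs_inner_update_sub_le (τ := τ) C β j (U - V) hq h'
  have e2 := abs_inner_update_sub_le (τ := τ) C β' j (U - V) hq h'
  rw [← hU] at e1
  rw [← hV] at e2
  have f1 : X a - update X τ C β j = (X a - C j) - U := by rw [hU]; abel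
  have f2 : X a - update X τ C β' j = (X a - C j) - V := by rw [hV]; abel
  rw [f1, f2, norm_sub_sq_real _ U, norm_sub_sq_real _ V]
  -- The quadratic terms also reduce to inner products with U - V, and U and V are controlled
  -- through the directions `X a - C j`. Together with the linear term this gives 2q + q + q = 4q.
  have e3 : inner ℝ (U - V) U + inner ℝ (U - V) V = ‖U‖ ^ 2 - ‖V‖ ^ 2 := by
    rw [← inner_add_right, inner_sub_left U V, inner_add_right, inner_add_right,
      real_inner_self_eq_norm_sq, real_inner_self_eq_norm_sq, real_inner_comm U V]
    ring
  have e4 := h j a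
  rw [← hU, ← hV] at e4
  linarith [(abs_le.1 e1).2, (abs_le.1 e2).2, (abs_le.1 e4).1]

theorem cost_eq_of_isNearest (hk : 0 < k) (hτ : IsNearest X τ) (C : Fin k → Pt d) (a : Fin n) :
    cost C (X a) = ‖X a - C (τ C a)‖ ^ 2 := by
  refine le_antisymm (cost_le _ _ _) ?_
  obtain ⟨j, hj⟩ := exists_cost_eq hk C (X a)
  rw [hj]
  have := hτ C a j
  gcongr

/-- By Cauchy–Schwarz the squared norm of the sum contributes a factor |P|, which cancels against
the squared rate |P|/b and leaves a part of the batch cost. -/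
theorem norm_update_sub_sq_le (hk : 0 < k) (hτ : IsNearest X τ) (C : Fin k → Pt d)
    (β : Fin b → Fin n) (j : Fin k) :
    ‖update X τ C β j - C j‖ ^ 2 ≤ objective (fun l => X (β l)) C := by
  set P := part τ C β j with hP
  have h1 : ‖∑ l ∈ P, (X (β l) - C j)‖ ^ 2 ≤ P.card * ∑ l ∈ P, ‖X (β l) - C j‖ ^ 2 := by
    refine le_trans ?_ sq_sum_le_card_mul_sum_sq
    gcongr
    exact norm_sum_le _ _
  have h2 : ∑ l ∈ P, ‖X (β l) - C j‖ ^ 2 ≤ ∑ l, cost C (X (β l)) := by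
    have : ∑ l ∈ P, ‖X (β l) - C j‖ ^ 2 = ∑ l ∈ P, cost C (X (β l)) := by
      refine Finset.sum_congr rfl fun l hl => ?_
      rw [cost_eq_of_isNearest hk hτ, (Finset.mem_filter.1 hl).2]
    rw [this]
    exact Finset.sum_le_sum_of_subset_of_nonneg (Finset.subset_univ _)
      fun _ _ _ => cost_nonneg _ _
  have h3 : 0 ≤ ∑ l, cost C (X (β l)) := Finset.sum_nonneg fun _ _ => cost_nonneg _ _
  rw [update_sub, norm_smul, norm_smul, mul_pow, mul_pow, ← hP]
  simp only [Real.norm_eq_abs, sq_abs, div_pow, one_pow]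
  rw [Real.sq_sqrt (weight_nonneg _ _ _), objective, weight, ← hP]
  calc 1 / ((P.card : ℝ) / b) * (1 / (b : ℝ) ^ 2 * ‖∑ l ∈ P, (X (β l) - C j)‖ ^ 2)
      ≤ 1 / ((P.card : ℝ) / b) * (1 / (b : ℝ) ^ 2 * (P.card * ∑ l, cost C (X (β l)))) := by
        gcongr
        exact h1.trans (by gcongr)
    _ = (P.card / P.card : ℝ) * ((b : ℝ) / b) * (1 / (b : ℝ) * ∑ l, cost C (X (β l))) := by
        simp only [div_eq_mul_inv, mul_inv, inv_inv, one_mul]; ring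
    _ ≤ 1 * 1 * (1 / (b : ℝ) * ∑ l, cost C (X (β l))) := by
        gcongr
        · exact div_self_le_one _
        · exact div_self_le_one _
    _ = _ := by ring

/-- One update at most doubles the cost, up to twice the cost of the batch. -/
theorem objective_update_le (hn : 0 < n) (hk : 0 < k) (hτ : IsNearest X τ) (C : Fin k → Pt d)
    (β : Fin b → Fin n) :
    objective X (update X τ C β) ≤ 2 * objective X C + 2 * objective (fun l => X (β l)) C := by
  have hn' : (0 : ℝ) < n := by exact_mod_cast hn
  set q := objective (fun l => X (β l)) C with hq
  have h : ∀ a, cost (update X τ C β) (X a) ≤ 2 * cost C (X a) + 2 * q := fun a => by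
    obtain ⟨j, hj⟩ := exists_cost_eq hk C (X a)
    have h1 := cost_le (update X τ C β) (X a) j
    have h2 := norm_sub_sq_le_two_mul (X a) (C j) (update X τ C β j)
    have h3 := norm_update_sub_sq_le hk hτ C β j
    rw [norm_sub_rev] at h3
    rw [hj]
    linarith
  unfold objective
  calc 1 / (n : ℝ) * ∑ a, cost (update X τ C β) (X a)
      ≤ 1 / (n : ℝ) * ∑ a, (2 * cost C (X a) + 2 * q) := by
        gcongr with a _
        exact h a
    _ = 2 * (1 / (n : ℝ) * ∑ a, cost C (X a)) + 2 * q := by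
        simp only [Finset.sum_add_distrib, ← Finset.mul_sum, Finset.sum_const, Finset.card_univ,
          Fintype.card_fin, nsmul_eq_mul]
        field_simp

/-! ### Good batches -/

/-- A batch is good for the centers `C` if its cost is close to the cost of the data, both before
and after the update. -/
def IsGood (X : Fin n → Pt d) (τ : (Fin k → Pt d) → Fin n → Fin k) (ε : ℝ) (C : Fin k → Pt d)
    (β : Fin b → Fin n) : Prop :=
  objective (fun l => X (β l)) C ≤ objective X C + ε / 5 ∧
  objective X (update X τ C β) ≤ objective (fun l => X (β l)) (update X τ C β) + 3 * ε / 5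

/-- The functions of a data point whose averages over the batch have to be close to those over the
data: the assignment to a center, the assignment weighted by inner products, and the costs for the
current and the ideally updated centers. -/
noncomputable def testFun (X : Fin n → Pt d) (τ : (Fin k → Pt d) → Fin n → Fin k)
    (C : Fin k → Pt d) : (Fin k × Option (Fin n)) ⊕ Bool → Fin n → ℝ
  | .inl (j, none), a => if τ C a = j then 1 else 0
  | .inl (j, some x), a => if τ C a = j then inner ℝ (X x - C j) (X a - C j) / d else 0
  | .inr true, a => cost C (X a) / d
  | .inr false, a => cost (update X τ C (id : Fin n → Fin n)) (X a) / d

theorem abs_inner_div_dim_le (hX : ∀ a c, X a c ∈ Set.Icc (0 : ℝ) 1) {C : Fin k → Pt d}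
    (hC : InCube C) (j : Fin k) (x a : Fin n) :
    |inner ℝ (X x - C j) (X a - C j) / (d : ℝ)| ≤ 1 := by
  rw [abs_div, Nat.abs_cast]
  refine div_le_one_of_le₀ ?_ (Nat.cast_nonneg _)
  refine (abs_real_inner_le_norm _ _).trans ?_
  have h1 := norm_sub_sq_le_dim (hX x) (hC j)
  have h2 := norm_sub_sq_le_dim (hX a) (hC j)
  nlinarith [sq_nonneg (‖X x - C j‖ - ‖X a - C j‖)]

theorem abs_testFun_le (hk : 0 < k) (hX : ∀ a c, X a c ∈ Set.Icc (0 : ℝ) 1) {C : Fin k → Pt d}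
    (hC : InCube C) (i : (Fin k × Option (Fin n)) ⊕ Bool) (a : Fin n) :
    |testFun X τ C i a| ≤ 1 := by
  have hcost : ∀ {C : Fin k → Pt d}, InCube C → |cost C (X a) / (d : ℝ)| ≤ 1 := fun hC => by
    rw [abs_of_nonneg (div_nonneg (cost_nonneg _ _) (Nat.cast_nonneg _))]
    exact div_le_one_of_le₀ (cost_le_dim hk hC (hX a)) (Nat.cast_nonneg _)
  rcases i with ⟨j, _ | x⟩ | _ | _
  · simp only [testFun]; split_ifs <;> simp
  · simp only [testFun]
    split_ifs
    · exact abs_inner_div_dim_le hX hC j x a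
    · simp
  · exact hcost (update_mem_cube hX hC _)
  · exact hcost hC

/-- The bound on the mean squares of the test functions, at least `r`. -/
noncomputable def testVar (τ : (Fin k → Pt d) → Fin n → Fin k)
    (C : Fin k → Pt d) (r : ℝ) : (Fin k × Option (Fin n)) ⊕ Bool → ℝ
  | .inl (j, _) => max (weight τ C (id : Fin n → Fin n) j) r
  | .inr _ => 1

theorem sum_indicator_eq (C : Fin k → Pt d) (β : Fin b → Fin n) (j : Fin k) :
    1 / (b : ℝ) * ∑ l, (if τ C (β l) = j then (1 : ℝ) else 0) = weight τ C β j := by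
  simp only [Finset.sum_boole, weight, part]
  ring

theorem mean_testFun_sq_le (hn : 0 < n) (hk : 0 < k) (hX : ∀ a c, X a c ∈ Set.Icc (0 : ℝ) 1)
    {C : Fin k → Pt d} (hC : InCube C) (r : ℝ) (i : (Fin k × Option (Fin n)) ⊕ Bool) :
    1 / (n : ℝ) * ∑ a, testFun X τ C i a ^ 2 ≤ testVar τ C r i := by
  have hn' : (0 : ℝ) < n := by exact_mod_cast hn
  have h1 : ∀ i a, testFun X τ C i a ^ 2 ≤ 1 := fun i a =>
    (sq_le_one_iff_abs_le_one _).2 (abs_testFun_le hk hX hC i a)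
  rcases i with ⟨j, o⟩ | i
  · refine le_trans ?_ (le_max_left _ _)
    rw [← sum_indicator_eq]
    gcongr with a _
    simp only [id_eq]
    split_ifs with h
    · exact h1 _ a
    · cases o <;> simp [testFun, h]
  · simp only [testVar]
    rw [one_div, inv_mul_le_iff₀ hn']
    refine (Finset.sum_le_sum fun a _ => h1 (.inr i) a).trans (le_of_eq ?_)
    simp

/-- A batch with accurate averages of all test functions is good. -/
theorem isGood_of_testFun (hn : 0 < n) (hk : 0 < k) (hb : 0 < b)
    (hX : ∀ a c, X a c ∈ Set.Icc (0 : ℝ) 1) {C : Fin k → Pt d} (hC : InCube C) {ε : ℝ}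
    (hε : 0 < ε) (hd : 0 < d) (β : Fin b → Fin n)
    (h : ∀ i, |1 / (b : ℝ) * ∑ l, testFun X τ C i (β l) - 1 / (n : ℝ) * ∑ a, testFun X τ C i a|
      ≤ 2 * √(testVar τ C ((ε / (80 * d)) ^ 2) i * (ε / (80 * d)) ^ 2)) :
    IsGood X τ ε C β := by
  have hd' : (0 : ℝ) < d := by exact_mod_cast hd
  -- With this r, the displacement error d · 4√r equals ε/20, and a change of the costs by 4 · ε/20
  -- = ε/5 results.
  set r : ℝ := (ε / (80 * d)) ^ 2 with hr
  have hr0 : 0 < r := by positivity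
  have hsr : √r = ε / (80 * d) := Real.sqrt_sq (by positivity)
  have hobj : ∀ (C' : Fin k → Pt d), |1 / (b : ℝ) * ∑ l, cost C' (X (β l)) / (d : ℝ)
      - 1 / (n : ℝ) * ∑ a, cost C' (X a) / (d : ℝ)| ≤ 2 * √(1 * r) →
      |objective (fun l => X (β l)) C' - objective X C'| ≤ ε / 5 := by
    intro C' h'
    rw [one_mul, hsr, ← Finset.sum_div, ← Finset.sum_div] at h'
    have e : objective (fun l => X (β l)) C' - objective X C' = d * (1 / (b : ℝ)
        * ((∑ l, cost C' (X (β l))) / (d : ℝ)) - 1 / (n : ℝ) * ((∑ a, cost C' (X a)) / (d : ℝ))) := by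
      unfold objective; field_simp
    rw [e, abs_mul, abs_of_pos hd']
    refine (mul_le_mul_of_nonneg_left h' hd'.le).trans ?_
    have : (d : ℝ) * (2 * (ε / (80 * d))) = ε / 40 := by field_simp; norm_num
    rw [this]
    linarith
  have hC1 := hobj C (h (.inr true))
  set C' := update X τ C β with hC'
  set D := update X τ C (id : Fin n → Fin n) with hD
  have hD1 := hobj D (h (.inr false))
  have hclose : ∀ j a, |inner ℝ (X a - C j) (C' j - C j) - inner ℝ (X a - C j) (D j - C j)|
      ≤ ε / 20 := by
    intro j a
    have hpart : ∀ {b' : ℕ} (β' : Fin b' → Fin n),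
        inner ℝ (X a - C j) (update X τ C β' j - C j)
          = d * ((1 / (b' : ℝ) * ∑ l, testFun X τ C (.inl (j, some a)) (β' l))
            / √(weight τ C β' j)) := by
      intro b' β'
      rw [inner_update_sub]
      simp only [testFun, part, ← Finset.sum_filter, ← Finset.sum_div]
      field_simp
    have hbound : ∀ {b' : ℕ} (β' : Fin b' → Fin n),
        |1 / (b' : ℝ) * ∑ l, testFun X τ C (.inl (j, some a)) (β' l)| ≤ weight τ C β' j := by
      intro b' β'
      rw [abs_mul, abs_of_nonneg (by positivity : (0 : ℝ) ≤ 1 / b'), ← sum_indicator_eq]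
      gcongr
      refine (Finset.abs_sum_le_sum_abs _ _).trans (Finset.sum_le_sum fun l _ => ?_)
      split_ifs with h
      · exact abs_testFun_le hk hX hC _ _
      · simp [testFun, h]
    have h1 := h (.inl (j, some a))
    have h2 := h (.inl (j, none))
    have e1 : 1 / (b : ℝ) * ∑ l, testFun X τ C (.inl (j, none)) (β l) = weight τ C β j :=
      sum_indicator_eq C β j
    have e2 : 1 / (n : ℝ) * ∑ a, testFun X τ C (.inl (j, none)) a
        = weight τ C (id : Fin n → Fin n) j := sum_indicator_eq C (id : Fin n → Fin n) j
    rw [e1, e2] at h2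
    have h3 := abs_div_sqrt_sub_div_sqrt_le hr0 (hbound β) (hbound (id : Fin n → Fin n)) h1 h2
    rw [hC', hD, hpart, hpart, ← mul_sub, abs_mul, abs_of_pos hd']
    refine (mul_le_mul_of_nonneg_left h3 hd'.le).trans (le_of_eq ?_)
    rw [hsr]
    field_simp
    norm_num
  have hclose' : ∀ j a, |inner ℝ (X a - C j) (D j - C j) - inner ℝ (X a - C j) (C' j - C j)|
      ≤ ε / 20 := fun j a => by rw [abs_sub_comm]; exact hclose j a
  -- The passage from the data to the batch goes through the ideal update D: from C' to D on the
  -- data, from data to batch at D, and back to C' on the batch, each at a price of at most ε/5.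
  have g1 : objective X C' ≤ objective X D + 4 * (ε / 20) :=
    objective_mono X hn (cost_update_le hk C β (id : Fin n → Fin n) hclose)
  have g2 : objective (fun l => X (β l)) D ≤ objective (fun l => X (β l)) C' + 4 * (ε / 20) :=
    objective_mono _ hb fun l => cost_update_le hk C (id : Fin n → Fin n) β hclose' (β l)
  refine ⟨?_, ?_⟩
  · linarith [(abs_le.1 hC1).2]
  · linarith [(abs_le.1 hD1).1]

open Classical in
theorem batchMean_not_isGood_le (hn : 0 < n) (hk : 0 < k) (hb : 0 < b)
    (hX : ∀ a c, X a c ∈ Set.Icc (0 : ℝ) 1) {C : Fin k → Pt d} (hC : InCube C) {ε : ℝ}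
    (hε : 0 < ε) (hεd : ε ≤ d) :
    batchMean (fun β : Fin b → Fin n => if IsGood X τ ε C β then (0 : ℝ) else 1)
      ≤ 8 * (n * k) * Real.exp (-(b * (ε / (80 * d)) ^ 2)) := by
  have hd' : (0 : ℝ) < d := hε.trans_le hεd
  have hd : 0 < d := by exact_mod_cast hd'
  set r : ℝ := (ε / (80 * d)) ^ 2 with hr
  have hr0 : 0 < r := by positivity
  have hr1 : r ≤ 1 := by
    rw [hr]
    refine pow_le_one₀ (by positivity) ((div_le_one (by positivity)).2 (by linarith))
  have h := batchMean_exists_abs_le (b := b) hn hb (testFun X τ C) (testVar τ C r)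
    (abs_testFun_le hk hX hC) (mean_testFun_sq_le hn hk hX hC r) hr0 (by
      rintro (⟨j, o⟩ | i)
      · exact le_max_right _ _
      · exact hr1)
  have hcard : (Fintype.card ((Fin k × Option (Fin n)) ⊕ Bool) : ℝ) ≤ 4 * (n * k) := by
    have h1 : (1 : ℝ) ≤ n := by exact_mod_cast hn
    have h2 : (1 : ℝ) ≤ k := by exact_mod_cast hk
    simp only [Fintype.card_sum, Fintype.card_prod, Fintype.card_fin, Fintype.card_option,
      Fintype.card_bool]
    push_cast
    nlinarith
  calc _ ≤ _ := batchMean_mono fun β => ?_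
    _ ≤ _ := h
    _ ≤ 2 * (4 * (n * k)) * Real.exp (-(b * r)) := by gcongr
    _ = _ := by ring
  by_cases hg : IsGood X τ ε C β
  · rw [if_pos hg]; split_ifs <;> norm_num
  · rw [if_neg hg, if_pos]
    by_contra hcon
    push Not at hcon
    exact hg (isGood_of_testFun hn hk hb hX hC hε hd β fun i => (hcon i).le)

end MiniBatchKMeans

/-! ### Drift of one iteration, and conditioning on the history. -/

namespace MiniBatchKMeans

/-! ### One iteration from fixed centers -/

variable {d n k b : ℕ} {X : Fin n → Pt d} {τ : (Fin k → Pt d) → Fin n → Fin k}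

/-- The stopping condition for the centers `C` and the batch `β`. -/
def StepStops (X : Fin n → Pt d) (τ : (Fin k → Pt d) → Fin n → Fin k) (ε : ℝ) (C : Fin k → Pt d)
    (β : Fin b → Fin n) : Prop :=
  objective (fun l => X (β l)) C - objective (fun l => X (β l)) (update X τ C β) < ε

/-- The gain ε on the batch exceeds the two transfer errors ε/5 and 3ε/5 by ε/5. -/
theorem IsGood.objective_update_le_sub {ε : ℝ} {C : Fin k → Pt d} {β : Fin b → Fin n}
    (h : IsGood X τ ε C β) (hs : ¬ StepStops X τ ε C β) :
    objective X (update X τ C β) ≤ objective X C - ε / 5 := by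
  obtain ⟨h1, h2⟩ := h
  unfold StepStops at hs
  linarith

theorem objective_le_dim (hk : 0 < k) (hX : ∀ a c, X a c ∈ Set.Icc (0 : ℝ) 1) {C : Fin k → Pt d}
    (hC : InCube C) : objective X C ≤ d :=
  objective_le_of_cost_le _ (Nat.cast_nonneg _) fun a => cost_le_dim hk hC (hX a)

open Classical in
/-- The cost, weighted by `10` as long as the algorithm runs, does not increase in expectation. -/
theorem batchMean_step_le (hn : 0 < n) (hk : 0 < k) (hb : 0 < b)
    (hX : ∀ a c, X a c ∈ Set.Icc (0 : ℝ) 1) (hτ : IsNearest X τ) {C : Fin k → Pt d}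
    (hC : InCube C) {ε δ : ℝ} (hε : 0 < ε) (hεd : ε ≤ d)
    (hδ : batchMean (fun β : Fin b → Fin n => if IsGood X τ ε C β then (0 : ℝ) else 1) ≤ δ)
    (hδd : 60 * (δ * d) ≤ ε) (hbd : 4 * (d : ℝ) ^ 2 ≤ b * ε ^ 2) :
    batchMean (fun β : Fin b → Fin n => if StepStops X τ ε C β
      then objective X (update X τ C β) else 10 * objective X (update X τ C β))
      ≤ 10 * objective X C := by
  set f := objective X C with hf
  have hf0 : 0 ≤ f := objective_nonneg _ _
  have hd0 : (0 : ℝ) < d := hε.trans_le hεd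
  have hub : ∀ β : Fin b → Fin n, objective X (update X τ C β) ≤ d := fun β =>
    objective_le_dim hk hX (update_mem_cube hX hC β)
  have hδ0 : 0 ≤ δ := (batchMean_nonneg fun β => by split_ifs <;> norm_num).trans hδ
  -- At f ≥ ε/10 a good terminating step costs at most 4f + 2ε/5 ≤ 10f - ε/5, the same bound as for
  -- a good step that continues. The remaining ε/5 absorbs the bad batches.
  rcases le_or_gt (ε / 10) f with hcase | hcase
  · have hpt : ∀ β : Fin b → Fin n, (if StepStops X τ ε C β
        then objective X (update X τ C β) else 10 * objective X (update X τ C β))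
        ≤ (10 * f - ε / 5) + (10 * d + ε / 5) * (if IsGood X τ ε C β then (0 : ℝ) else 1) := by
      intro β
      have h0 := objective_nonneg X (update X τ C β)
      have h1 := objective_update_le hn hk hτ C β
      have h2 := hub β
      by_cases hg : IsGood X τ ε C β
      · rw [if_pos hg]
        split_ifs with hs
        · have := hg.1
          linarith
        · have := hg.objective_update_le_sub hs
          linarith
      · rw [if_neg hg]
        split_ifs <;> linarith
    refine (batchMean_mono hpt).trans ?_
    rw [batchMean_add, batchMean_const hn, batchMean_const_mul]
    nlinarith [mul_le_mul_of_nonneg_left hδ (show 0 ≤ 10 * (d : ℝ) + ε / 5 by linarith)]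
  · have hpt : ∀ β : Fin b → Fin n, (if StepStops X τ ε C β
        then objective X (update X τ C β) else 10 * objective X (update X τ C β))
        ≤ (2 * f + 2 * objective (fun l => X (β l)) C)
          + 20 * d / ε ^ 2 * (objective (fun l => X (β l)) C - f) ^ 2 := by
      intro β
      have h0 := objective_nonneg X (update X τ C β)
      have h1 := objective_update_le hn hk hτ C β
      have h2 := hub β
      have hpos : 0 ≤ 20 * d / ε ^ 2 * (objective (fun l => X (β l)) C - f) ^ 2 := by positivity
      split_ifs with hs
      · linarith
      -- Continuing requires a batch cost of at least ε, a deviation of at least 9ε/10 from f. The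
      -- trivial bound 10d is then dominated by the squared deviation, whose mean contributes at
      -- most 5f.
      · have h3 : ε ≤ objective (fun l => X (β l)) C := by
          have := objective_nonneg (fun l => X (β l)) (update X τ C β)
          unfold StepStops at hs
          linarith
        have h4 : 9 * ε / 10 ≤ objective (fun l => X (β l)) C - f := by linarith
        have h5 : ε ^ 2 / 2 ≤ (objective (fun l => X (β l)) C - f) ^ 2 := by nlinarith
        have h6 : 10 * (d : ℝ) ≤ 20 * d / ε ^ 2 * (objective (fun l => X (β l)) C - f) ^ 2 := by
          calc 10 * (d : ℝ) = 20 * d / ε ^ 2 * (ε ^ 2 / 2) := by field_simp; norm_num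
            _ ≤ _ := by gcongr
        have h7 := objective_nonneg (fun l => X (β l)) C
        linarith
    refine (batchMean_mono hpt).trans ?_
    rw [batchMean_add, batchMean_add, batchMean_const hn, batchMean_const_mul, batchMean_const_mul,
      batchMean_objective hn hb]
    have hv := batchMean_sq_sub_le (b := b) hn hb X C (M := d) fun a => cost_le_dim hk hC (hX a)
    have hb0 : (0 : ℝ) < b := by exact_mod_cast hb
    have h8 : 20 * d / ε ^ 2 * (d * f / b) ≤ 5 * f := by
      have e : 20 * d / ε ^ 2 * (d * f / b) = 5 * f * (4 * (d : ℝ) ^ 2 / (b * ε ^ 2)) := by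
        field_simp
        ring
      rw [e]
      refine mul_le_of_le_one_right (by positivity) ((div_le_one (by positivity)).2 hbd)
    have h9 := mul_le_mul_of_nonneg_left hv (show 0 ≤ 20 * (d : ℝ) / ε ^ 2 by positivity)
    linarith

open Classical in
/-- As long as the algorithm runs, the cost decreases in expectation. -/
theorem batchMean_alive_le (hn : 0 < n) (hk : 0 < k)
    (hX : ∀ a c, X a c ∈ Set.Icc (0 : ℝ) 1) {C : Fin k → Pt d}
    (hC : InCube C) {ε δ : ℝ} (hε : 0 < ε) (hεd : ε ≤ d)
    (hδ : batchMean (fun β : Fin b → Fin n => if IsGood X τ ε C β then (0 : ℝ) else 1) ≤ δ)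
    (hδd : 60 * (δ * d) ≤ ε) :
    batchMean (fun β : Fin b → Fin n => if StepStops X τ ε C β
      then 0 else objective X (update X τ C β) + ε / 5) ≤ objective X C + ε / 10 := by
  set f := objective X C with hf
  have hf0 : 0 ≤ f := objective_nonneg _ _
  have hδ0 : 0 ≤ δ := (batchMean_nonneg fun β => by split_ifs <;> norm_num).trans hδ
  have hpt : ∀ β : Fin b → Fin n, (if StepStops X τ ε C β
      then 0 else objective X (update X τ C β) + ε / 5)
      ≤ f + (d + ε / 5) * (if IsGood X τ ε C β then (0 : ℝ) else 1) := by
    intro β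
    have h2 := objective_le_dim hk hX (update_mem_cube (τ := τ) hX hC β)
    by_cases hg : IsGood X τ ε C β
    · rw [if_pos hg]
      split_ifs with hs
      · linarith
      · have := hg.objective_update_le_sub hs
        linarith
    · rw [if_neg hg]
      split_ifs <;> linarith
  refine (batchMean_mono hpt).trans ?_
  rw [batchMean_add, batchMean_const hn, batchMean_const_mul]
  nlinarith [mul_le_mul_of_nonneg_left hδ (show 0 ≤ (d : ℝ) + ε / 5 by linarith)]

/-! ### Dependence on the history -/

/-- `F` depends only on the seeding and on the batches before iteration `i`. -/
def DependsBefore {α : Type*} (i : ℕ)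
    (F : (Fin k → Fin n) → (ℕ → Fin b → Fin n) → α) : Prop :=
  ∀ s B B', (∀ j < i, B j = B' j) → F s B = F s B'

/-- The algorithm has not stopped before iteration `N`. -/
def Alive (X : Fin n → Pt d) (τ : (Fin k → Pt d) → Fin n → Fin k) (ε : ℝ)
    (s : Fin k → Fin n) (B : ℕ → Fin b → Fin n) (N : ℕ) : Prop :=
  ∀ i < N, ¬ StopsAt X τ ε s B i

theorem stopsAt_iff {ε : ℝ} {s : Fin k → Fin n} {B : ℕ → Fin b → Fin n} {i : ℕ} :
    StopsAt X τ ε s B i ↔ StepStops X τ ε (centers X τ s B i) (B i) := Iff.rfl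

theorem centers_congr {s : Fin k → Fin n} {B B' : ℕ → Fin b → Fin n} {i : ℕ}
    (h : ∀ j < i, B j = B' j) : centers X τ s B i = centers X τ s B' i := by
  induction i with
  | zero => rfl
  | succ i ih =>
    simp only [centers]
    rw [ih fun j hj => h j (by omega), h i (by omega)]

theorem stopsAt_congr {ε : ℝ} {s : Fin k → Fin n} {B B' : ℕ → Fin b → Fin n} {i : ℕ}
    (h : ∀ j ≤ i, B j = B' j) : StopsAt X τ ε s B i ↔ StopsAt X τ ε s B' i := by
  rw [stopsAt_iff, stopsAt_iff, centers_congr fun j hj => h j hj.le, h i le_rfl]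

theorem alive_congr {ε : ℝ} {s : Fin k → Fin n} {B B' : ℕ → Fin b → Fin n} {N : ℕ}
    (h : ∀ j < N, B j = B' j) : Alive X τ ε s B N ↔ Alive X τ ε s B' N :=
  forall₂_congr fun _ hi => not_congr (stopsAt_congr fun j hj => h j (hj.trans_lt hi))

theorem Alive.mono {ε : ℝ} {s : Fin k → Fin n} {B : ℕ → Fin b → Fin n} {N M : ℕ}
    (h : Alive X τ ε s B N) (hM : M ≤ N) : Alive X τ ε s B M := fun i hi => h i (hi.trans_le hM)

theorem alive_succ {ε : ℝ} {s : Fin k → Fin n} {B : ℕ → Fin b → Fin n} {N : ℕ} :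
    Alive X τ ε s B (N + 1) ↔ Alive X τ ε s B N ∧ ¬ StopsAt X τ ε s B N := by
  simp only [Alive, Nat.lt_succ_iff_lt_or_eq, or_imp, forall_and, forall_eq]

theorem lastIter_eq {ε : ℝ} {s : Fin k → Fin n} {B : ℕ → Fin b → Fin n} {N : ℕ}
    (h : Alive X τ ε s B N) (hs : StopsAt X τ ε s B N) : lastIter X τ ε s B = N := by
  refine le_antisymm (Nat.sInf_le hs) ?_
  by_contra hlt
  exact h _ (not_le.1 hlt) (Nat.sInf_mem (s := {i | StopsAt X τ ε s B i}) ⟨N, hs⟩)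

theorem exists_stop_of_not_alive {ε : ℝ} {s : Fin k → Fin n} {B : ℕ → Fin b → Fin n} {N : ℕ}
    (h : ¬ Alive X τ ε s B N) : ∃ j < N, Alive X τ ε s B j ∧ StopsAt X τ ε s B j := by
  induction N with
  | zero => exact absurd (fun i hi => absurd hi (Nat.not_lt_zero i)) h
  | succ N ih =>
    by_cases hN : Alive X τ ε s B N
    · exact ⟨N, by omega, hN, by_contra fun hs => h (alive_succ.2 ⟨hN, hs⟩)⟩
    · obtain ⟨j, hj, h'⟩ := ih hN
      exact ⟨j, by omega, h'⟩

/-- Although the output may involve arbitrarily late batches, it is determined by the first N of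
them on the event that the run has stopped by then. -/
theorem output_congr {ε : ℝ} {s : Fin k → Fin n} {B B' : ℕ → Fin b → Fin n} {N : ℕ}
    (h : ∀ j < N, B j = B' j) (hN : ¬ Alive X τ ε s B N) :
    output X τ ε s B = output X τ ε s B' := by
  obtain ⟨j, hj, h1, h2⟩ := exists_stop_of_not_alive hN
  have h1' : Alive X τ ε s B' j := (alive_congr fun i hi => h i (hi.trans hj)).1 h1
  have h2' : StopsAt X τ ε s B' j := (stopsAt_congr fun i hi => h i (hi.trans_lt hj)).1 h2
  rw [output, output, lastIter_eq h1 h2, lastIter_eq h1' h2']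
  exact centers_congr fun i hi => h i (by omega)

theorem centers_inCube (hX : ∀ a c, X a c ∈ Set.Icc (0 : ℝ) 1) (s : Fin k → Fin n)
    (B : ℕ → Fin b → Fin n) (i : ℕ) : InCube (centers X τ s B i) := by
  induction i with
  | zero => exact fun j => hX (s j)
  | succ i ih => exact update_mem_cube hX ih _

/-! ### Integration over the next batch -/

theorem integral_comp_of_finite {Ω α : Type*} [MeasurableSpace Ω] {P : Measure Ω}
    [IsFiniteMeasure P] [Fintype α] [MeasurableSpace α] [MeasurableSingletonClass α] {Y : Ω → α}
    (hY : Measurable Y) (H : α → ℝ) : ∫ ω, H (Y ω) ∂P = ∑ y, P.real (Y ⁻¹' {y}) * H y := by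
  rw [← integral_map hY.aemeasurable (Measurable.of_discrete).aestronglyMeasurable,
    integral_fintype Integrable.of_finite]
  refine Finset.sum_congr rfl fun y _ => ?_
  rw [map_measureReal_apply hY (measurableSet_singleton y), smul_eq_mul]

/-- Fubini for finite-valued variables. Since seedings and batches take finitely many values, this
replaces conditional expectations. -/
theorem integral_indepFun_of_finite {Ω α β : Type*} [MeasurableSpace Ω] {P : Measure Ω}
    [IsFiniteMeasure P] [Fintype α] [MeasurableSpace α] [MeasurableSingletonClass α] [Fintype β]
    [MeasurableSpace β] [MeasurableSingletonClass β] {Y : Ω → α} {Z : Ω → β}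
    (hY : Measurable Y) (hZ : Measurable Z) (h : ∀ y z,
      P.real (Y ⁻¹' {y} ∩ Z ⁻¹' {z}) = P.real (Y ⁻¹' {y}) * P.real (Z ⁻¹' {z}))
    (G : α → β → ℝ) :
    ∫ ω, G (Y ω) (Z ω) ∂P = ∫ ω, ∑ z, P.real (Z ⁻¹' {z}) * G (Y ω) z ∂P := by
  rw [integral_comp_of_finite (hY.prodMk hZ) (fun q => G q.1 q.2),
    integral_comp_of_finite hY (fun y => ∑ z, P.real (Z ⁻¹' {z}) * G y z),
    Fintype.sum_prod_type]
  refine Finset.sum_congr rfl fun y _ => ?_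
  rw [Finset.mul_sum]
  refine Finset.sum_congr rfl fun z _ => ?_
  rw [← mul_assoc, ← h, ← Set.singleton_prod_singleton, Set.mk_preimage_prod]

variable {Ω : Type*} {s : Ω → Fin k → Fin n} {B : ℕ → Ω → Fin b → Fin n}

/-- The seeding and the first `i` batches. -/
def history (s : Ω → Fin k → Fin n) (B : ℕ → Ω → Fin b → Fin n) (i : ℕ) (ω : Ω) :
    (Fin k → Fin n) × (Fin i → Fin b → Fin n) := (s ω, fun j => B j ω)

/-- A tuple of batches, continued by a constant sequence. -/
def extendBatches (hn : 0 < n) (i : ℕ) (h : Fin i → Fin b → Fin n) : ℕ → Fin b → Fin n :=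
  fun j => if hj : j < i then h ⟨j, hj⟩ else fun _ => ⟨0, hn⟩

theorem DependsBefore.eq_history {α : Type*} (hn : 0 < n) {i : ℕ}
    {F : (Fin k → Fin n) → (ℕ → Fin b → Fin n) → α} (hF : DependsBefore i F) (ω : Ω) :
    F (s ω) (fun j => B j ω)
      = F (history s B i ω).1 (extendBatches hn i (history s B i ω).2) :=
  hF _ _ _ fun j hj => by simp [extendBatches, hj, history]

variable [MeasurableSpace Ω] {P : Measure Ω}

theorem measurable_history (hs : Measurable s) (hB : ∀ i, Measurable (B i)) (i : ℕ) :
    Measurable (history s B i) :=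
  hs.prodMk (measurable_pi_lambda _ fun j => hB j)

theorem history_indep (hB : ∀ i, Measurable (B i))
    (hind : iIndepFun B P) (hsB : IndepFun s (fun ω i => B i ω) P) (i : ℕ)
    (y : (Fin k → Fin n) × (Fin i → Fin b → Fin n)) (z : Fin b → Fin n) :
    P.real (history s B i ⁻¹' {y} ∩ B i ⁻¹' {z})
      = P.real (history s B i ⁻¹' {y}) * P.real (B i ⁻¹' {z}) := by
  obtain ⟨σ, h⟩ := y
  have hpast : IndepFun (fun ω (j : Fin i) => B j ω) (B i) P :=
    (hind.indepFun_finset (Finset.range i) {i} (by simp) hB).comp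
      (φ := fun g (j : Fin i) => g ⟨j, Finset.mem_range.2 j.2⟩)
      (ψ := fun g => g ⟨i, Finset.mem_singleton_self i⟩)
      (measurable_pi_lambda _ fun j => measurable_pi_apply _) (measurable_pi_apply _)
  have hM : Measurable (fun (g : ℕ → Fin b → Fin n) (j : Fin i) => g j) :=
    measurable_pi_lambda _ fun j => measurable_pi_apply _
  have real_mul : ∀ {S T : Set Ω}, P (S ∩ T) = P S * P T → P.real (S ∩ T) = P.real S * P.real T :=
    fun h => by rw [measureReal_def, h, ENNReal.toReal_mul]; rfl
  have e1 := real_mul <| hsB.measure_inter_preimage_eq_mul _ _ (measurableSet_singleton σ)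
    ((hM (measurableSet_singleton h)).inter ((measurable_pi_apply i) (measurableSet_singleton z)))
  have e2 := real_mul <| hsB.measure_inter_preimage_eq_mul _ _ (measurableSet_singleton σ)
    (hM (measurableSet_singleton h))
  have e3 := real_mul <| hpast.measure_inter_preimage_eq_mul _ _ (measurableSet_singleton h)
    (measurableSet_singleton z)
  have f1 : history s B i ⁻¹' {(σ, h)} = s ⁻¹' {σ} ∩ (fun ω (j : Fin i) => B j ω) ⁻¹' {h} := by
    ext ω; simp [history, Prod.ext_iff]
  rw [f1, Set.inter_assoc]
  refine e1.trans ?_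
  refine Eq.trans ?_ (congrArg (· * P.real (B i ⁻¹' {z})) e2.symm)
  rw [mul_assoc]
  congr 1

variable [IsProbabilityMeasure P]

theorem DependsBefore.integrable (hn : 0 < n) (hs : Measurable s) (hB : ∀ i, Measurable (B i))
    {i : ℕ} {F : (Fin k → Fin n) → (ℕ → Fin b → Fin n) → ℝ} (hF : DependsBefore i F) :
    Integrable (fun ω => F (s ω) (fun j => B j ω)) P := by
  have h : (fun ω => F (s ω) (fun j => B j ω))
      = (fun q : (Fin k → Fin n) × (Fin i → Fin b → Fin n) => F q.1 (extendBatches hn i q.2))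
        ∘ history s B i := funext fun ω => hF.eq_history hn ω
  rw [h]
  exact Integrable.comp_measurable Integrable.of_finite (measurable_history hs hB i)

theorem DependsBefore.measurableSet (hn : 0 < n) (hs : Measurable s) (hB : ∀ i, Measurable (B i))
    {i : ℕ} {F : (Fin k → Fin n) → (ℕ → Fin b → Fin n) → Prop} (hF : DependsBefore i F) :
    MeasurableSet {ω | F (s ω) (fun j => B j ω)} := by
  have h : {ω | F (s ω) (fun j => B j ω)} = history s B i ⁻¹' {q | F q.1 (extendBatches hn i q.2)} :=
    Set.ext fun ω => iff_of_eq (hF.eq_history hn ω)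
  rw [h]
  exact measurable_history hs hB i (Set.toFinite _).measurableSet

theorem integral_step (hn : 0 < n) (hs : Measurable s) (hB : ∀ i, Measurable (B i))
    (hlaw : ∀ (i : ℕ) (β : Fin b → Fin n), P.real (B i ⁻¹' {β}) = 1 / (n : ℝ) ^ b)
    (hind : iIndepFun B P) (hsB : IndepFun s (fun ω i => B i ω) P) (i : ℕ)
    {F : (Fin k → Fin n) → (ℕ → Fin b → Fin n) → (Fin b → Fin n) → ℝ} (hF : DependsBefore i F) :
    ∫ ω, F (s ω) (fun j => B j ω) (B i ω) ∂P
      = ∫ ω, batchMean (F (s ω) (fun j => B j ω)) ∂P := by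
  have h := integral_indepFun_of_finite (measurable_history hs hB i) (hB i)
    (history_indep hB hind hsB i) (fun q β => F q.1 (extendBatches hn i q.2) β)
  simp only [hlaw, ← Finset.mul_sum] at h
  simp only [hF.eq_history hn]
  exact h

end MiniBatchKMeans

/-! ### Termination, expected cost and failure probability. -/

namespace MiniBatchKMeans

/-! ### The run of the algorithm -/

/-- A random seeding `s` and independent, uniform batches `B`. -/
structure IsRun {n k b : ℕ} {Ω : Type*} [MeasurableSpace Ω] (P : Measure Ω)
    (s : Ω → Fin k → Fin n) (B : ℕ → Ω → Fin b → Fin n) : Prop where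
  measurable_seed : Measurable s
  measurable_batch : ∀ i, Measurable (B i)
  batch_law : ∀ (i : ℕ) (β : Fin b → Fin n), P.real (B i ⁻¹' {β}) = 1 / (n : ℝ) ^ b
  batch_indep : iIndepFun B P
  seed_indep : IndepFun s (fun ω i => B i ω) P

variable {d n k b : ℕ} {X : Fin n → Pt d} {τ : (Fin k → Pt d) → Fin n → Fin k}
  {Ω : Type*} [MeasurableSpace Ω] {P : Measure Ω} [IsProbabilityMeasure P]
  {s : Ω → Fin k → Fin n} {B : ℕ → Ω → Fin b → Fin n} {ε δ : ℝ}

theorem IsRun.integrable (h : IsRun P s B) (hn : 0 < n) (i : ℕ)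
    {F : (Fin k → Fin n) → (ℕ → Fin b → Fin n) → ℝ} (hF : DependsBefore i F) :
    Integrable (fun ω => F (s ω) (fun j => B j ω)) P :=
  hF.integrable hn h.measurable_seed h.measurable_batch

theorem IsRun.integral_step (h : IsRun P s B) (hn : 0 < n) (i : ℕ)
    {F : (Fin k → Fin n) → (ℕ → Fin b → Fin n) → (Fin b → Fin n) → ℝ} (hF : DependsBefore i F) :
    ∫ ω, F (s ω) (fun j => B j ω) (B i ω) ∂P
      = ∫ ω, batchMean (F (s ω) (fun j => B j ω)) ∂P :=
  MiniBatchKMeans.integral_step hn h.measurable_seed h.measurable_batch h.batch_law h.batch_indep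
    h.seed_indep i hF

theorem IsRun.integral_step_le (h : IsRun P s B) (hn : 0 < n) (i : ℕ)
    {F : (Fin k → Fin n) → (ℕ → Fin b → Fin n) → (Fin b → Fin n) → ℝ}
    {G : (Fin k → Fin n) → (ℕ → Fin b → Fin n) → ℝ} (hF : DependsBefore i F)
    (hG : DependsBefore i G) (hFG : ∀ σ β, batchMean (F σ β) ≤ G σ β) :
    ∫ ω, F (s ω) (fun j => B j ω) (B i ω) ∂P ≤ ∫ ω, G (s ω) (fun j => B j ω) ∂P := by
  rw [h.integral_step hn i hF]
  exact integral_mono (h.integrable hn i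
    (F := fun σ β => batchMean (F σ β)) fun σ β β' hβ => by simp only [hF σ β β' hβ])
    (h.integrable hn i hG) fun ω => hFG _ _

open Classical in
-- The potential f + ε/5, counted only while the run is alive, loses ε/10 on average per live
-- iteration and starts at no more than 2d. Hence survival up to N has probability O(d/(εN)).
theorem IsRun.integral_alive_le (h : IsRun P s B) (hn : 0 < n) (hk : 0 < k)
    (hX : ∀ a c, X a c ∈ Set.Icc (0 : ℝ) 1) (hε : 0 < ε) (hεd : ε ≤ d)
    (hδ : ∀ C, InCube C →
      batchMean (fun β : Fin b → Fin n => if IsGood X τ ε C β then (0 : ℝ) else 1) ≤ δ)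
    (hδd : 60 * (δ * d) ≤ ε) (N : ℕ) :
    ∫ ω, (if Alive X τ ε (s ω) (fun i => B i ω) N
        then objective X (centers X τ (s ω) (fun i => B i ω) N) + ε / 5 else 0) ∂P
      + N * (ε / 10) * ∫ ω, (if Alive X τ ε (s ω) (fun i => B i ω) N then (1 : ℝ) else 0) ∂P
      ≤ 2 * d := by
  induction N with
  | zero =>
    have h1 : ∀ ω, (if Alive X τ ε (s ω) (fun i => B i ω) 0
        then objective X (centers X τ (s ω) (fun i => B i ω) 0) + ε / 5 else 0) ≤ 2 * d := by
      intro ω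
      have := objective_le_dim hk hX (centers_inCube (τ := τ) hX (s ω) (fun i => B i ω) 0)
      split_ifs <;> linarith
    have h2 := integral_mono (μ := P) (h.integrable hn 0
      (F := fun s B => if Alive X τ ε s B 0 then objective X (centers X τ s B 0) + ε / 5 else 0)
      fun σ β β' hβ => by simp only [alive_congr hβ, centers_congr hβ])
      (integrable_const (2 * (d : ℝ))) h1
    simp only [integral_const, probReal_univ, one_smul] at h2
    simpa using h2
  | succ N ih =>
    have halive1 : Integrable (fun ω => if Alive X τ ε (s ω) (fun i => B i ω) N
        then (1 : ℝ) else 0) P := h.integrable hn N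
      (F := fun s B => if Alive X τ ε s B N then (1 : ℝ) else 0)
      fun σ β β' hβ => by simp only [alive_congr hβ]
    have halive2 : Integrable (fun ω => if Alive X τ ε (s ω) (fun i => B i ω) (N + 1)
        then (1 : ℝ) else 0) P := h.integrable hn (N + 1)
      (F := fun s B => if Alive X τ ε s B (N + 1) then (1 : ℝ) else 0)
      fun σ β β' hβ => by simp only [alive_congr hβ]
    have hZ : Integrable (fun ω => if Alive X τ ε (s ω) (fun i => B i ω) N
        then objective X (centers X τ (s ω) (fun i => B i ω) N) + ε / 5 else 0) P :=
      h.integrable hn N (F := fun s B => if Alive X τ ε s B N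
        then objective X (centers X τ s B N) + ε / 5 else 0)
      fun σ β β' hβ => by simp only [alive_congr hβ, centers_congr hβ]
    have hanti : ∫ ω, (if Alive X τ ε (s ω) (fun i => B i ω) (N + 1) then (1 : ℝ) else 0) ∂P
        ≤ ∫ ω, (if Alive X τ ε (s ω) (fun i => B i ω) N then (1 : ℝ) else 0) ∂P := by
      refine integral_mono halive2 halive1 fun ω => ?_
      dsimp only
      by_cases hA : Alive X τ ε (s ω) (fun i => B i ω) (N + 1)
      · rw [if_pos hA, if_pos (hA.mono (Nat.le_succ N))]
      · rw [if_neg hA]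
        split_ifs <;> norm_num
    have hstep := h.integral_step_le hn N
      (F := fun s B β => if Alive X τ ε s B N then (if StepStops X τ ε (centers X τ s B N) β
        then 0 else objective X (update X τ (centers X τ s B N) β) + ε / 5) else 0)
      (G := fun s B => (if Alive X τ ε s B N then objective X (centers X τ s B N) + ε / 5 else 0)
        - ε / 10 * (if Alive X τ ε s B N then 1 else 0))
      (fun σ β β' hβ => by simp only [alive_congr hβ, centers_congr hβ])
      (fun σ β β' hβ => by simp only [alive_congr hβ, centers_congr hβ])
      (fun σ β => by
        by_cases hA : Alive X τ ε σ β N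
        · simp only [if_pos hA]
          have hC := centers_inCube (τ := τ) hX σ β N
          have := batchMean_alive_le hn hk hX hC hε hεd (hδ _ hC) hδd
          linarith
        · simp only [if_neg hA]
          rw [batchMean_const hn]
          simp)
    have heq : ∀ ω, (if Alive X τ ε (s ω) (fun i => B i ω) N then
        (if StepStops X τ ε (centers X τ (s ω) (fun i => B i ω) N) (B N ω)
        then 0 else objective X (update X τ (centers X τ (s ω) (fun i => B i ω) N) (B N ω)) + ε / 5)
          else 0) = if Alive X τ ε (s ω) (fun i => B i ω) (N + 1)
        then objective X (centers X τ (s ω) (fun i => B i ω) (N + 1)) + ε / 5 else 0 := by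
      intro ω
      simp only [alive_succ, stopsAt_iff, centers]
      split_ifs <;> tauto
    rw [integral_congr_ae (Filter.Eventually.of_forall heq),
      integral_sub hZ (halive1.const_mul _), integral_const_mul] at hstep
    have := mul_le_mul_of_nonneg_left hanti (show 0 ≤ ((N + 1 : ℕ) : ℝ) * (ε / 10) by positivity)
    push_cast at this ⊢
    linarith

open Classical in
-- The one-step drift, iterated; after stopping, the integrand is frozen at the cost of the output.
theorem IsRun.integral_weighted_le (h : IsRun P s B) (hn : 0 < n) (hk : 0 < k) (hb : 0 < b)
    (hX : ∀ a c, X a c ∈ Set.Icc (0 : ℝ) 1) (hτ : IsNearest X τ) (hε : 0 < ε) (hεd : ε ≤ d)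
    (hδ : ∀ C, InCube C →
      batchMean (fun β : Fin b → Fin n => if IsGood X τ ε C β then (0 : ℝ) else 1) ≤ δ)
    (hδd : 60 * (δ * d) ≤ ε) (hbd : 4 * (d : ℝ) ^ 2 ≤ b * ε ^ 2) (N : ℕ) :
    ∫ ω, (if Alive X τ ε (s ω) (fun i => B i ω) N
        then 10 * objective X (centers X τ (s ω) (fun i => B i ω) N)
        else objective X (output X τ ε (s ω) (fun i => B i ω))) ∂P
      ≤ 10 * ∫ ω, objective X (fun j => X (s ω j)) ∂P := by
  induction N with
  | zero =>
    rw [← integral_const_mul]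
    refine (integral_congr_ae (Filter.Eventually.of_forall fun ω => ?_)).le
    exact if_pos fun i hi => absurd hi (Nat.not_lt_zero i)
  | succ N ih =>
    have hdep : ∀ (σ : Fin k → Fin n) (β β' : ℕ → Fin b → Fin n) (g : ℝ), (∀ j < N, β j = β' j) →
        (if Alive X τ ε σ β N then g else objective X (output X τ ε σ β))
          = if Alive X τ ε σ β' N then g else objective X (output X τ ε σ β') := by
      intro σ β β' g hβ
      by_cases hA : Alive X τ ε σ β N
      · rw [if_pos hA, if_pos ((alive_congr hβ).1 hA)]
      · rw [if_neg hA, if_neg ((alive_congr hβ).not.1 hA), output_congr hβ hA]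
    have hstep := h.integral_step_le hn N
      (F := fun s B β => if Alive X τ ε s B N then (if StepStops X τ ε (centers X τ s B N) β
        then objective X (update X τ (centers X τ s B N) β)
        else 10 * objective X (update X τ (centers X τ s B N) β))
        else objective X (output X τ ε s B))
      (G := fun s B => (if Alive X τ ε s B N then 10 * objective X (centers X τ s B N)
        else objective X (output X τ ε s B)))
      (fun σ β β' hβ => by simp only [centers_congr hβ, hdep σ β β' _ hβ])
      (fun σ β β' hβ => by simp only [centers_congr hβ, hdep σ β β' _ hβ])
      (fun σ β => by
        by_cases hA : Alive X τ ε σ β N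
        · simp only [if_pos hA]
          have hC := centers_inCube (τ := τ) hX σ β N
          exact batchMean_step_le hn hk hb hX hτ hC hε hεd (hδ _ hC) hδd hbd
        · simp only [if_neg hA]
          rw [batchMean_const hn])
    refine le_trans (le_of_eq (integral_congr_ae (Filter.Eventually.of_forall fun ω => ?_)))
      (hstep.trans ih)
    dsimp only
    by_cases hA : Alive X τ ε (s ω) (fun i => B i ω) N
    · by_cases hS : StopsAt X τ ε (s ω) (fun i => B i ω) N
      · rw [if_neg fun hA' => (alive_succ.1 hA').2 hS, if_pos hA, if_pos (stopsAt_iff.1 hS), output,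
          lastIter_eq hA hS]
        rfl
      · rw [if_pos (alive_succ.2 ⟨hA, hS⟩), if_pos hA, if_neg (stopsAt_iff.not.1 hS)]
        rfl
    · rw [if_neg fun hA' => hA (alive_succ.1 hA').1, if_neg hA]

theorem output_inCube (hX : ∀ a c, X a c ∈ Set.Icc (0 : ℝ) 1) (σ : Fin k → Fin n)
    (β : ℕ → Fin b → Fin n) : InCube (output X τ ε σ β) := centers_inCube hX _ _ _

open Classical in
/-- Almost sure termination, and the expected cost of the returned centers. -/
theorem IsRun.terminates_and_integral_output_le (h : IsRun P s B) (hn : 0 < n) (hk : 0 < k)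
    (hb : 0 < b) (hX : ∀ a c, X a c ∈ Set.Icc (0 : ℝ) 1) (hτ : IsNearest X τ) (hε : 0 < ε)
    (hεd : ε ≤ d)
    (hδ : ∀ C, InCube C →
      batchMean (fun β : Fin b → Fin n => if IsGood X τ ε C β then (0 : ℝ) else 1) ≤ δ)
    (hδd : 60 * (δ * d) ≤ ε) (hbd : 4 * (d : ℝ) ^ 2 ≤ b * ε ^ 2) :
    (∀ᵐ ω ∂P, Terminates X τ ε (s ω) (fun i => B i ω)) ∧
    Integrable (fun ω => objective X (output X τ ε (s ω) (fun i => B i ω))) P ∧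
    ∫ ω, objective X (output X τ ε (s ω) (fun i => B i ω)) ∂P
      ≤ 10 * ∫ ω, objective X (fun j => X (s ω j)) ∂P := by
  have hd0 : (0 : ℝ) < d := hε.trans_le hεd
  set p : ℕ → ℝ := fun N =>
    ∫ ω, (if Alive X τ ε (s ω) (fun i => B i ω) N then (1 : ℝ) else 0) ∂P with hp
  have halive : ∀ N, Integrable (fun ω => if Alive X τ ε (s ω) (fun i => B i ω) N
      then (1 : ℝ) else 0) P := fun N => h.integrable hn N
    (F := fun s B => if Alive X τ ε s B N then (1 : ℝ) else 0)
    fun σ β β' hβ => by simp only [alive_congr hβ]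
  have hmeas : ∀ N, MeasurableSet {ω | Alive X τ ε (s ω) (fun i => B i ω) N} := fun N =>
    DependsBefore.measurableSet hn h.measurable_seed h.measurable_batch
      (F := fun s B => Alive X τ ε s B N) fun σ β β' hβ => propext (alive_congr hβ)
  have hpP : ∀ N, P.real {ω | Alive X τ ε (s ω) (fun i => B i ω) N} = p N := fun N => by
    rw [← integral_indicator_one (hmeas N)]
    rfl
  have hp0 : Filter.Tendsto p Filter.atTop (nhds 0) := by
    have hb : ∀ N, p (N + 1) ≤ 20 * d / ε * (1 / ((N : ℝ) + 1)) := by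
      intro N
      have h1 := h.integral_alive_le (τ := τ) hn hk hX hε hεd hδ hδd (N + 1)
      have h2 : 0 ≤ ∫ ω, (if Alive X τ ε (s ω) (fun i => B i ω) (N + 1)
        then objective X (centers X τ (s ω) (fun i => B i ω) (N + 1)) + ε / 5 else 0) ∂P := by
        refine integral_nonneg fun ω => ?_
        have := objective_nonneg X (centers X τ (s ω) (fun i => B i ω) (N + 1))
        rw [Pi.zero_apply]
        split_ifs <;> linarith
      have h3 : ((N : ℝ) + 1) * (ε / 10) * p (N + 1) ≤ 2 * d := by
        push_cast at h1
        linarith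
      have h4 : 20 * d / ε * (1 / ((N : ℝ) + 1)) = 2 * d / (((N : ℝ) + 1) * (ε / 10)) := by
        field_simp
        norm_num
      rw [h4, le_div_iff₀ (by positivity)]
      linarith
    rw [← Filter.tendsto_add_atTop_iff_nat 1]
    refine squeeze_zero (fun N => ?_) hb ?_
    · rw [← hpP]; exact measureReal_nonneg
    · simpa using tendsto_one_div_add_atTop_nhds_zero_nat.const_mul (20 * d / ε)
  have hterm : ∀ᵐ ω ∂P, Terminates X τ ε (s ω) (fun i => B i ω) := by
    have h0 : P.real {ω | ¬ Terminates X τ ε (s ω) (fun i => B i ω)} ≤ 0 := by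
      refine ge_of_tendsto' hp0 fun N => ?_
      rw [← hpP]
      exact measureReal_mono fun ω hω i _ hi => hω ⟨i, hi⟩
    rw [ae_iff]
    have h1 := le_antisymm h0 measureReal_nonneg
    exact (measureReal_eq_zero_iff (measure_ne_top _ _)).1 h1
  set W : ℕ → Ω → ℝ := fun N ω => if Alive X τ ε (s ω) (fun i => B i ω) N
        then 10 * objective X (centers X τ (s ω) (fun i => B i ω) N)
        else objective X (output X τ ε (s ω) (fun i => B i ω)) with hW
  have hWint : ∀ N, Integrable (W N) P := fun N => h.integrable hn N
    (F := fun s B => if Alive X τ ε s B N then 10 * objective X (centers X τ s B N)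
        else objective X (output X τ ε s B)) fun σ β β' hβ => by
      by_cases hA : Alive X τ ε σ β N
      · simp only [if_pos hA, if_pos ((alive_congr hβ).1 hA), centers_congr hβ]
      · simp only [if_neg hA, if_neg ((alive_congr hβ).not.1 hA), output_congr hβ hA]
  have hout : ∀ ω, objective X (output X τ ε (s ω) (fun i => B i ω)) ≤ d := fun ω =>
    objective_le_dim hk hX (output_inCube hX _ _)
  have hint : Integrable (fun ω => objective X (output X τ ε (s ω) (fun i => B i ω))) P := by
    -- The output depends on no fixed number of batches; its cost is measurable as the almost sure
    -- limit of the functions `W N`, which are eventually constant.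
    refine Integrable.of_bound (C := d) ?_ (Filter.Eventually.of_forall fun ω => ?_)
    · refine aestronglyMeasurable_of_tendsto_ae Filter.atTop (fun N => (hWint N).1) ?_
      filter_upwards [hterm] with ω hω
      obtain ⟨i, hi⟩ := hω
      refine tendsto_const_nhds.congr' ?_
      filter_upwards [Filter.eventually_gt_atTop i] with N hN
      exact (if_neg fun hA : Alive X τ ε (s ω) (fun i => B i ω) N => hA i hN hi).symm
    · rw [Real.norm_of_nonneg (objective_nonneg _ _)]
      exact hout ω
  refine ⟨hterm, hint, ?_⟩
  -- Pointwise, the output costs at most `W N`, plus d on the event that the run is still alive.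
  have hbound : ∀ N, ∫ ω, objective X (output X τ ε (s ω) (fun i => B i ω)) ∂P
      ≤ 10 * ∫ ω, objective X (fun j => X (s ω j)) ∂P + d * p N := by
    intro N
    refine le_trans ?_ (add_le_add_left
      (h.integral_weighted_le hn hk hb hX hτ hε hεd hδ hδd hbd N) _)
    rw [hp, ← integral_const_mul, ← integral_add (hWint N) ((halive N).const_mul _)]
    refine integral_mono hint ((hWint N).add ((halive N).const_mul _)) fun ω => ?_
    dsimp only
    have h1 := hout ω
    by_cases hA : Alive X τ ε (s ω) (fun i => B i ω) N
    · have := objective_nonneg X (centers X τ (s ω) (fun i => B i ω) N)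
      simp only [hW, if_pos hA]
      linarith
    · simp only [hW, if_neg hA]
      linarith
  have hlim := (hp0.const_mul (d : ℝ)).const_add (10 * ∫ ω, objective X (fun j => X (s ω j)) ∂P)
  rw [mul_zero, add_zero] at hlim
  exact ge_of_tendsto' hlim hbound

/-- If all batches of the first iterations are good, then the algorithm stops in time, and the cost
decreases until then. -/
theorem terminates_of_isGood (hk : 0 < k) (hX : ∀ a c, X a c ∈ Set.Icc (0 : ℝ) 1) (hε : 0 < ε)
    (σ : Fin k → Fin n) (β : ℕ → Fin b → Fin n)
    (hg : ∀ i < ⌊5 * d / ε⌋₊ + 1, IsGood X τ ε (centers X τ σ β i) (β i)) :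
    Terminates X τ ε σ β ∧ (lastIter X τ ε σ β : ℝ) + 1 ≤ 5 * d / ε + 1 ∧
      ∀ i : ℕ, i < lastIter X τ ε σ β → objective X (centers X τ σ β (i + 1))
        ≤ objective X (centers X τ σ β i) - ε / 5 := by
  set N := ⌊5 * d / ε⌋₊ with hN
  have hstep : ∀ i < N + 1, ¬ StopsAt X τ ε σ β i → objective X (centers X τ σ β (i + 1))
        ≤ objective X (centers X τ σ β i) - ε / 5 := fun i hi hs =>
    (hg i hi).objective_update_le_sub (stopsAt_iff.not.1 hs)
  -- After N + 1 > 5d/ε decreases by ε/5 from at most d, the cost would be negative.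
  have hdead : ¬ Alive X τ ε σ β (N + 1) := by
    intro hA
    have hdec : ∀ i ≤ N + 1, objective X (centers X τ σ β i) ≤ d - i * (ε / 5) := by
      intro i
      induction i with
      | zero =>
        intro _
        simpa using objective_le_dim hk hX (centers_inCube hX σ β 0)
      | succ i ih =>
        intro hi
        have h1 := ih (by omega)
        have h2 := hstep i (by omega) (hA i (by omega))
        push_cast
        linarith
    have h1 := hdec (N + 1) le_rfl
    have h2 := objective_nonneg X (centers X τ σ β (N + 1))
    have h3 := Nat.lt_floor_add_one (5 * d / ε)
    rw [← hN, div_lt_iff₀ hε] at h3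
    push_cast at h1
    linarith
  obtain ⟨j, hj, h1, h2⟩ := exists_stop_of_not_alive hdead
  refine ⟨⟨j, h2⟩, ?_, ?_⟩
  · rw [lastIter_eq h1 h2]
    have h3 : (N : ℝ) ≤ 5 * d / ε := Nat.floor_le (by positivity)
    have h4 : (j : ℝ) ≤ N := by exact_mod_cast Nat.lt_succ_iff.1 hj
    linarith
  · rw [lastIter_eq h1 h2]
    exact fun i hi => hstep i (by omega) (h1 i hi)

open Classical in
theorem IsRun.le_measureReal_terminates (h : IsRun P s B) (hn : 0 < n) (hk : 0 < k)
    (hX : ∀ a c, X a c ∈ Set.Icc (0 : ℝ) 1) (hε : 0 < ε)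
    (hδ : ∀ C, InCube C →
      batchMean (fun β : Fin b → Fin n => if IsGood X τ ε C β then (0 : ℝ) else 1) ≤ δ) :
    1 - (5 * d / ε + 1) * δ ≤ P.real {ω | Terminates X τ ε (s ω) (fun i => B i ω) ∧
        (lastIter X τ ε (s ω) (fun i => B i ω) : ℝ) + 1 ≤ 5 * d / ε + 1 ∧
        ∀ i : ℕ, i < lastIter X τ ε (s ω) (fun i => B i ω) →
          objective X (centers X τ (s ω) (fun i => B i ω) (i + 1))
            ≤ objective X (centers X τ (s ω) (fun i => B i ω) i) - ε / 5} := by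
  set N := ⌊5 * d / ε⌋₊ with hN
  set bad : ℕ → Set Ω := fun i => {ω | ¬ IsGood X τ ε (centers X τ (s ω) (fun i => B i ω) i) (B i ω)}
    with hbad
  have hmeas : ∀ i, MeasurableSet (bad i) := fun i =>
    DependsBefore.measurableSet (i := i + 1) hn h.measurable_seed h.measurable_batch
      (F := fun s B => ¬ IsGood X τ ε (centers X τ s B i) (B i)) fun σ β β' hβ => by
        simp only [centers_congr fun j hj => hβ j (hj.trans i.lt_succ_self), hβ i i.lt_succ_self]
  -- The zero centers lie in the cube, so the hypothesis on δ is not vacuous.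
  have hδ0 : 0 ≤ δ := (batchMean_nonneg fun β => by split_ifs <;> norm_num).trans
    (hδ (fun _ => 0) fun _ _ => by simp)
  have hbadP : ∀ i, P.real (bad i) ≤ δ := by
    intro i
    have hstep := h.integral_step_le hn i
      (F := fun s B β => if IsGood X τ ε (centers X τ s B i) β then (0 : ℝ) else 1)
      (G := fun _ _ => δ) (fun σ β β' hβ => by simp only [centers_congr hβ])
      (fun _ _ _ _ => rfl) (fun σ β => hδ _ (centers_inCube hX σ β i))
    rw [integral_const, probReal_univ, one_smul] at hstep
    refine le_trans (le_of_eq ?_) hstep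
    rw [← integral_indicator_one (hmeas i)]
    refine integral_congr_ae (Filter.Eventually.of_forall fun ω => ?_)
    simp only [Set.indicator, hbad, Set.mem_ofPred_eq, Pi.one_apply, ite_not]
  have hunion : P.real (⋃ i ∈ Finset.range (N + 1), bad i) ≤ (5 * d / ε + 1) * δ := by
    refine (measureReal_biUnion_finset_le _ _).trans
      ((Finset.sum_le_sum fun i _ => hbadP i).trans ?_)
    rw [Finset.sum_const, Finset.card_range, nsmul_eq_mul]
    have h3 : (N : ℝ) ≤ 5 * d / ε := Nat.floor_le (by positivity)
    push_cast
    gcongr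
  have hcompl := probReal_compl_eq_one_sub (μ := P)
    (Finset.measurableSet_biUnion (Finset.range (N + 1)) fun i _ => hmeas i)
  refine le_trans (by rw [hcompl]; linarith) (measureReal_mono (?_ :
    (⋃ i ∈ Finset.range (N + 1), bad i)ᶜ ⊆ _))
  intro ω hω
  refine terminates_of_isGood hk hX hε (s ω) (fun i => B i ω) fun i hi => ?_
  by_contra hb
  exact hω (Set.mem_biUnion (Finset.mem_coe.2 (Finset.mem_range.2 hi)) hb)

/-- The case in which the algorithm stops in its first iteration. -/
theorem IsRun.terminates_and_integral_output_le_of_small (h : IsRun P s B) (hn : 0 < n) (hk : 0 < k)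
    (hb : 0 < b) (hτ : IsNearest X τ)
    (hsmall : ∀ (σ : Fin k → Fin n) (β : Fin b → Fin n),
      objective (fun l => X (β l)) (fun j => X (σ j)) < ε) :
    (∀ ω, StopsAt X τ ε (s ω) (fun i => B i ω) 0) ∧
    Integrable (fun ω => objective X (output X τ ε (s ω) (fun i => B i ω))) P ∧
    ∫ ω, objective X (output X τ ε (s ω) (fun i => B i ω)) ∂P
      ≤ 10 * ∫ ω, objective X (fun j => X (s ω j)) ∂P := by
  have hhalt : ∀ ω, StopsAt X τ ε (s ω) (fun i => B i ω) 0 := fun ω => by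
    have h1 := hsmall (s ω) (B 0 ω)
    have h2 := objective_nonneg (fun l => X (B 0 ω l)) (centers X τ (s ω) (fun i => B i ω) (0 + 1))
    unfold StopsAt
    simp only [centers] at h2 ⊢
    linarith
  have hout : ∀ ω, output X τ ε (s ω) (fun i => B i ω)
      = update X τ (fun j => X (s ω j)) (B 0 ω) := fun ω => by
    rw [output, lastIter_eq (fun i hi => absurd hi (Nat.not_lt_zero i)) (hhalt ω)]
    rfl
  simp only [hout]
  refine ⟨hhalt, h.integrable hn 1 (F := fun s B => objective X (update X τ (fun j => X (s j)) (B 0)))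
    fun σ β β' hβ => by simp only [hβ 0 one_pos], ?_⟩
  rw [← integral_const_mul]
  refine h.integral_step_le hn 0 (F := fun s _ β => objective X (update X τ (fun j => X (s j)) β))
    (G := fun s _ => 10 * objective X (fun j => X (s j)))
    (fun _ _ _ _ => rfl) (fun _ _ _ _ => rfl) fun σ _ => ?_
  have h1 := batchMean_mono fun β : Fin b → Fin n =>
    objective_update_le hn hk hτ (fun j => X (σ j)) β
  rw [batchMean_add, batchMean_const hn, batchMean_const_mul, batchMean_objective hn hb] at h1
  have h2 := objective_nonneg X fun j => X (σ j)
  linarith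

theorem integral_objective_seed_le (hk : 0 < k) (hs : Measurable s)
    (hlaw : ∀ σ : Fin k → Fin n, P.real (s ⁻¹' {σ}) = kmeansppProb X σ) :
    ∫ ω, objective X (fun j => X (s ω j)) ∂P ≤ 16 * (1 + Real.log k) * opt k X := by
  rw [integral_comp_of_finite hs (fun σ => objective X fun j => X (σ j))]
  simp only [hlaw]
  have hlog := Real.log_natCast_nonneg k
  rw [opt, Real.mul_iInf_of_nonneg (by positivity)]
  exact le_ciInf fun C => sum_kmeansppProb_objective_le hk X C

/-- The failure probability of one batch for the required batch size. -/
theorem exp_neg_le_of_batch_size (hn : 2 ≤ n) (hk : 0 < k) (hε : 0 < ε) (hεd : ε ≤ d) {p : ℝ}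
    (hp : 1 ≤ p)
    (hb : 6400 * (p + 12) * ((d : ℝ) / ε) ^ 2 * Real.log ((n : ℝ) * k * d / ε) ≤ b) :
    2 ≤ (n : ℝ) * k * d / ε ∧ 4 * (d : ℝ) ^ 2 ≤ b * ε ^ 2 ∧
    Real.exp (-(b * (ε / (80 * d)) ^ 2))
      ≤ 1 / ((n : ℝ) * k * d / ε) ^ 12 * (1 / (n : ℝ) ^ p) := by
  have hd0 : (0 : ℝ) < d := hε.trans_le hεd
  have hn2 : (2 : ℝ) ≤ n := by exact_mod_cast hn
  have hk1 : (1 : ℝ) ≤ k := by exact_mod_cast hk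
  set Y := (n : ℝ) * k * d / ε with hY
  have hnY : (n : ℝ) ≤ Y := by
    have h1 : 1 ≤ (d : ℝ) / ε := (one_le_div hε).2 hεd
    calc (n : ℝ) = n * 1 * 1 := by ring
      _ ≤ n * k * (d / ε) := by gcongr
      _ = Y := by rw [hY]; ring
  have hY0 : 0 < Y := by linarith
  have hlog : 1 / 2 ≤ Real.log Y := by
    have h1 := Real.log_two_gt_d9
    have h2 := Real.log_le_log two_pos (hn2.trans hnY)
    linarith
  have hlogn : Real.log n ≤ Real.log Y := Real.log_le_log (by linarith) hnY
  refine ⟨hn2.trans hnY, ?_, ?_⟩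
  · have h1 : 4 * ((d : ℝ) / ε) ^ 2 ≤ b := by
      refine le_trans ?_ hb
      have h2 : 4 ≤ 6400 * (p + 12) * Real.log Y := by nlinarith
      calc 4 * ((d : ℝ) / ε) ^ 2 ≤ 6400 * (p + 12) * Real.log Y * ((d : ℝ) / ε) ^ 2 := by gcongr
        _ = _ := by ring
    calc 4 * (d : ℝ) ^ 2 = 4 * ((d : ℝ) / ε) ^ 2 * ε ^ 2 := by field_simp
      _ ≤ b * ε ^ 2 := by gcongr
  · have h1 : (p + 12) * Real.log Y ≤ b * (ε / (80 * d)) ^ 2 := by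
      calc (p + 12) * Real.log Y
          = 6400 * (p + 12) * ((d : ℝ) / ε) ^ 2 * Real.log Y * (ε / (80 * d)) ^ 2 := by
            field_simp
            norm_num
        _ ≤ b * (ε / (80 * d)) ^ 2 := by gcongr
    have h2 : 1 / Y ^ 12 = Real.exp (-(12 * Real.log Y)) := by
      rw [Real.exp_neg, show 12 * Real.log Y = Real.log (Y ^ 12) by rw [Real.log_pow]; norm_num,
        Real.exp_log (by positivity), one_div]
    have h3 : 1 / (n : ℝ) ^ p = Real.exp (-(Real.log n * p)) := by
      rw [Real.exp_neg, Real.rpow_def_of_pos (by linarith), one_div]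
    rw [h2, h3, ← Real.exp_add]
    refine Real.exp_le_exp.2 ?_
    nlinarith [mul_le_mul_of_nonneg_left hlogn (show 0 ≤ p by linarith)]

/-- The bounds on the failure probability of one batch that the analysis requires. -/
theorem failure_bounds (hn : 2 ≤ n) (hε : 0 < ε) (hεd : ε ≤ d) {p e : ℝ}
    (hp : 1 ≤ p) (hY : 2 ≤ (n : ℝ) * k * d / ε)
    (he : e ≤ 1 / ((n : ℝ) * k * d / ε) ^ 12 * (1 / (n : ℝ) ^ p)) :
    60 * (8 * (n * k) * e * d) ≤ ε ∧ (5 * d / ε + 1) * (8 * (n * k) * e) ≤ 1 / (n : ℝ) ^ p := by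
  have hd0 : (0 : ℝ) < d := hε.trans_le hεd
  have hn2 : (2 : ℝ) ≤ n := by exact_mod_cast hn
  set Y := (n : ℝ) * k * d / ε with hYdef
  set q := 1 / (n : ℝ) ^ p with hq
  have hq0 : 0 < q := by positivity
  have hq1 : q ≤ 1 := by
    rw [hq, div_le_one (by positivity)]
    exact Real.one_le_rpow (by linarith) (by linarith)
  -- The exponent 12 leaves a factor of at most 2⁻¹¹ because Y ≥ 2; it beats the constants 480 and
  -- 48 below.
  have hY11 : Y * (1 / Y ^ 12) ≤ 1 / 2 ^ 11 := by
    have : Y * (1 / Y ^ 12) = 1 / Y ^ 11 := by field_simp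
    rw [this]
    gcongr
  have hYe : Y * e ≤ 1 / 2 ^ 11 * q := by
    calc Y * e ≤ Y * (1 / Y ^ 12 * q) := by gcongr
      _ = Y * (1 / Y ^ 12) * q := by ring
      _ ≤ _ := by gcongr
  constructor
  · calc 60 * (8 * (n * k) * e * d) = 480 * (Y * e) * ε := by rw [hYdef]; field_simp; ring
      _ ≤ 480 * (1 / 2 ^ 11 * q) * ε := by gcongr
      _ ≤ 480 * (1 / 2 ^ 11 * 1) * ε := by gcongr
      _ ≤ ε := by linarith
  · rcases le_or_gt e 0 with he0 | he0
    · have : (5 * d / ε + 1) * (8 * (n * k) * e) ≤ 0 :=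
        mul_nonpos_of_nonneg_of_nonpos (by positivity)
          (mul_nonpos_of_nonneg_of_nonpos (by positivity) he0)
      linarith
    have h1 : 5 * d / ε + 1 ≤ 6 * (d / ε) := by
      have : 1 ≤ (d : ℝ) / ε := (one_le_div hε).2 hεd
      have h2 : 5 * d / ε = 5 * (d / ε) := by ring
      linarith
    calc (5 * d / ε + 1) * (8 * (n * k) * e) ≤ 6 * (d / ε) * (8 * (n * k) * e) := by gcongr
      _ = 48 * (Y * e) := by rw [hYdef]; ring
      _ ≤ 48 * (1 / 2 ^ 11 * q) := by gcongr
      _ ≤ q := by linarith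

end MiniBatchKMeans

/-! ### Assembly of the theorem. -/

theorem mainTheorem4 :
    ∃ K : ℝ, ∀ p : ℝ, 1 ≤ p → ∃ A : ℝ,
      ∀ (n d k b : ℕ) (ε : ℝ), 1 ≤ n → 1 ≤ k → 1 ≤ b → 0 < ε →
        A * ((d : ℝ) / ε) ^ 2 * Real.log ((n : ℝ) * k * d / ε) ≤ (b : ℝ) →
      ∀ X : Fin n → MiniBatchKMeans.Pt d, (∀ a c, X a c ∈ Set.Icc (0 : ℝ) 1) →
      ∀ τ : (Fin k → MiniBatchKMeans.Pt d) → Fin n → Fin k, MiniBatchKMeans.IsNearest X τ →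
      ∀ (Ω : Type*) [MeasurableSpace Ω] (P : Measure Ω) [IsProbabilityMeasure P]
        -- the random k-means++ seeding and the random batches
        (s : Ω → Fin k → Fin n) (B : ℕ → Ω → Fin b → Fin n),
        Measurable s → (∀ i, Measurable (B i)) →
        (∀ σ : Fin k → Fin n, P.real (s ⁻¹' {σ}) = MiniBatchKMeans.kmeansppProb X σ) →
        (∀ (i : ℕ) (β : Fin b → Fin n), P.real (B i ⁻¹' {β}) = 1 / (n : ℝ) ^ b) →
        iIndepFun B P → IndepFun s (fun ω i => B i ω) P →
      -- the algorithm terminates almost surely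
      (∀ᵐ ω ∂P, MiniBatchKMeans.Terminates X τ ε (s ω) (fun i => B i ω)) ∧
      -- the returned centers are `O(log k)`-approximate in expectation
      Integrable (fun ω => MiniBatchKMeans.objective X
        (MiniBatchKMeans.output X τ ε (s ω) (fun i => B i ω))) P ∧
      ∫ ω, MiniBatchKMeans.objective X
          (MiniBatchKMeans.output X τ ε (s ω) (fun i => B i ω)) ∂P
        ≤ K * (1 + Real.log k) * MiniBatchKMeans.opt k X ∧
      -- with high probability the algorithm terminates within `O(d / ε)` iterations, and every
      -- iteration before the last one decreases the global goal function by at least `ε / 5`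
      1 - 1 / (n : ℝ) ^ p ≤ P.real {ω |
        MiniBatchKMeans.Terminates X τ ε (s ω) (fun i => B i ω) ∧
        (MiniBatchKMeans.lastIter X τ ε (s ω) (fun i => B i ω) : ℝ) + 1 ≤ 5 * d / ε + 1 ∧
        ∀ i : ℕ, i < MiniBatchKMeans.lastIter X τ ε (s ω) (fun i => B i ω) →
          MiniBatchKMeans.objective X
              (MiniBatchKMeans.centers X τ (s ω) (fun i => B i ω) (i + 1))
            ≤ MiniBatchKMeans.objective X
              (MiniBatchKMeans.centers X τ (s ω) (fun i => B i ω) i) - ε / 5} := by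
  classical
  -- 160 is the product of 10 from the iterations and 16 from the seeding; 6400 = 80² comes from the
  -- choice of r.
  refine ⟨160, fun p hp => ⟨6400 * (p + 12), ?_⟩⟩
  intro n d k b ε hn hk hb hε hbatch X hX τ hτ Ω _ P _ s B hs hB hseed hlaw hind hsB
  have hrun : MiniBatchKMeans.IsRun P s B := ⟨hs, hB, hlaw, hind, hsB⟩
  have hinit := MiniBatchKMeans.integral_objective_seed_le hk hs hseed
  by_cases hmain : 2 ≤ n ∧ ε ≤ d
  · obtain ⟨hn2, hεd⟩ := hmain
    obtain ⟨hY, hbd, he⟩ := MiniBatchKMeans.exp_neg_le_of_batch_size hn2 hk hε hεd hp hbatch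
    obtain ⟨hδd, hδN⟩ := MiniBatchKMeans.failure_bounds hn2 hε hεd hp hY he
    have hδ := fun (C : Fin k → MiniBatchKMeans.Pt d) (hC : MiniBatchKMeans.InCube C) =>
      MiniBatchKMeans.batchMean_not_isGood_le (τ := τ) hn hk hb hX hC hε hεd
    obtain ⟨h1, h2, h3⟩ :=
      hrun.terminates_and_integral_output_le hn hk hb hX hτ hε hεd hδ hδd hbd
    refine ⟨h1, h2, by linarith, ?_⟩
    exact le_trans (by linarith) (hrun.le_measureReal_terminates hn hk hX hε hδ)
  -- For n = 1 or ε > d, the quantity nkd/ε need not be at least 2, so the batch size may give no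
  -- information. Every batch cost of the seeds is then below ε, the first iteration is the last,
  -- and the unbiasedness of the batch cost bounds the loss by a factor 4.
  · have hsmall : ∀ (σ : Fin k → Fin n) (β : Fin b → Fin n),
        MiniBatchKMeans.objective (fun l => X (β l)) (fun j => X (σ j)) < ε := by
      intro σ β
      rcases not_and_or.1 hmain with h | h
      · obtain rfl : n = 1 := by omega
        refine lt_of_le_of_lt (MiniBatchKMeans.objective_le_of_cost_le _ le_rfl fun l => ?_) hε
        refine (MiniBatchKMeans.cost_le _ _ ⟨0, hk⟩).trans ?_
        simp [Subsingleton.elim (β l) (σ ⟨0, hk⟩)]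
      · exact (MiniBatchKMeans.objective_le_of_cost_le _ (Nat.cast_nonneg d) fun l =>
          MiniBatchKMeans.cost_le_dim hk (fun j => hX (σ j)) (hX (β l))).trans_lt (not_le.1 h)
    obtain ⟨h1, h2, h3⟩ := hrun.terminates_and_integral_output_le_of_small hn hk hb hτ hsmall
    refine ⟨Filter.Eventually.of_forall fun ω => ⟨0, h1 ω⟩, h2, by linarith, ?_⟩
    have hlast : ∀ ω, MiniBatchKMeans.lastIter X τ ε (s ω) (fun i => B i ω) = 0 := fun ω =>
      Nat.le_zero.1 (Nat.sInf_le (h1 ω))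
    have hpow : 0 ≤ 1 / (n : ℝ) ^ p := by positivity
    refine le_trans (by rw [probReal_univ]; linarith) (measureReal_mono (μ := P)
      (s₁ := Set.univ) fun ω _ => ⟨⟨0, h1 ω⟩, ?_, ?_⟩)
    · rw [hlast]
      have : 0 ≤ 5 * d / ε := by positivity
      push_cast
      linarith
    · rw [hlast]
      exact fun i hi => absurd hi (Nat.not_lt_zero i)
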